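/- Let $d\ge 2$ and let $G$ be a probability measure on $\mathbb R$ such that, for some $b>a>0$ and $\alpha>0$, $G$ is supported on $[a,b]$ and is absolutely continuous with a density $\rho$ satisfying $\rho(x)\ge\alpha$ for almost every $x\in[a,b]$. Let $E(\mathbb Z^d)$ be the set of nearest-neighbour edges of $\mathbb Z^d$, let $(t_e)_{e\in E(\mathbb Z^d)}$ be independent random variables with common law $G$, and let $T(p)=\sum_{e\in p}t_e$ for a finite lattice path $p$. For $v\in\mathbb Z^d$ let $\gamma(0,v)$ be the (almost surely unique) path from $0$ to $v$ minimizing $T$, and let $p_e:=\mathbb P(e\in\gamma(0,v))$. Write $\|\cdot\|$ for the Euclidean norm and $\|e-e'\|$ for the Euclidean distance between the centers of the edges $e$ and $e'$. Then there exist constants $C$ and $n_0$, depending only on $G$ and $d$, such that the following holds for every $v\in\mathbb Z^d$ with $n:=\|v\|\ge n_0$. If $q:E(\mathbb Z^d)\to[0,\infty)$ satisfies $$\tfrac1{10}\,q_{e'}\le q_e\le 10\,q_{e'}\qquad\text{for all } e,e'\in E(\mathbb Z^d)\text{ with }\|e-e'\|\le 2\log n,$$ then $$\Big(\sum_{e\in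 E(\mathbb Z^d)}q_ep_e\Big)^d\le C\Big(\sum_{e\in E(\mathbb Z^d)}q_e^2\Big)^{\frac{d-1}{2}}\sum_{e\in E(\mathbb Z^d)}q_e ,$$ where the sums are taken in $[0,\infty]$. -/

import Mathlib

open scoped NNReal ENNReal
open MeasureTheory ProbabilityTheory

namespace FPP

/-- The hypercubic lattice: vertices `ℤ^d`, edges between points at `ℓ¹` distance one. -/
def lattice (d : ℕ) : SimpleGraph (Fin d → ℤ) where
  Adj x y := ∑ i, |x i - y i| = 1
  symm := ⟨fun x y h => by simpa only [abs_sub_comm] using h⟩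
  loopless := ⟨fun x h => by simp at h⟩

/-- The edge set `E(ℤ^d)`. -/
abbrev Edge (d : ℕ) : Type := (lattice d).edgeSet

/-- The inclusion of `ℤ^d` in `ℝ^d`, the latter with its Euclidean norm. -/
noncomputable def toEuclid {d : ℕ} (x : Fin d → ℤ) : EuclideanSpace ℝ (Fin d) :=
  WithLp.toLp 2 fun i => (x i : ℝ)

/-- The midpoint of an (unordered) pair of lattice points, in `ℝ^d`. -/
noncomputable def center {d : ℕ} : Sym2 (Fin d → ℤ) → EuclideanSpace ℝ (Fin d) :=
  Sym2.lift ⟨fun x y => (2 : ℝ)⁻¹ • (toEuclid x + toEuclid y),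
    fun x y => by simp only [add_comm]⟩

/-- The Euclidean distance `‖e - e'‖` between the centers of two edges. -/
noncomputable def edgeDist {d : ℕ} (e e' : Edge d) : ℝ :=
  dist (center (e : Sym2 (Fin d → ℤ))) (center (e' : Sym2 (Fin d → ℤ)))

/-- The passage time `T(p) = ∑_{e ∈ p} t_e` of a finite lattice path `p` in the environment `t`. -/
noncomputable def passageTime {d : ℕ} (t : Edge d → ℝ) {x y : Fin d → ℤ}
    (p : (lattice d).Walk x y) : ℝ :=
  (p.darts.map fun a => t ⟨a.edge, a.edge_mem⟩).sum

/-- A geodesic from `x` to `y` is a finite path from `x` to `y` whose passage time is least among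
all such paths, that is, a path attaining the infimum `T(x, y)`. -/
def IsGeodesic {d : ℕ} (t : Edge d → ℝ) {x y : Fin d → ℤ} (p : (lattice d).Walk x y) : Prop :=
  ∀ p' : (lattice d).Walk x y, passageTime t p ≤ passageTime t p'

/-- The set of edges of the geodesic `γ(x, y)`. For independent weights with an atomless common
law on the positive reals there is almost surely exactly one geodesic from `x` to `y`, and this is
then its set of edges. -/
def geodesicEdges {d : ℕ} (t : Edge d → ℝ) (x y : Fin d → ℤ) : Set (Edge d) :=
  {e | ∃ p : (lattice d).Walk x y, IsGeodesic t p ∧ (e : Sym2 (Fin d → ℤ)) ∈ p.edges}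

/-- The assumption on the weight distribution: for some `b > a > 0` and `α > 0`, the law `G` is
supported on `[a, b]` and has a density with respect to Lebesgue measure that is at least `α`
almost everywhere on `[a, b]`. -/
def IsAdmissible (G : Measure ℝ) : Prop :=
  ∃ a b α : ℝ, 0 < a ∧ a < b ∧ 0 < α ∧ G (Set.Icc a b)ᶜ = 0 ∧
    ∃ ρ : ℝ → ℝ≥0∞, Measurable ρ ∧ G = (volume : Measure ℝ).withDensity ρ ∧
      ∀ᵐ x ∂(volume : Measure ℝ), x ∈ Set.Icc a b → ENNReal.ofReal α ≤ ρ x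

/-- The environment: `t_e`, for `e ∈ E(ℤ^d)`, are independent random variables on `(Ω, P)` with
common law `G`. -/
structure IsIIDEnvironment {d : ℕ} {Ω : Type*} [MeasurableSpace Ω] (P : Measure Ω)
    (t : Edge d → Ω → ℝ) (G : Measure ℝ) : Prop where
  hasLaw : ∀ e, HasLaw (t e) G P
  indep : iIndepFun t P

/-- The probability `p_e = P(e ∈ γ(0, v))`, as an element of `[0, ∞]`. -/
noncomputable def geodesicProb {d : ℕ} {Ω : Type*} [MeasurableSpace Ω] (P : Measure Ω)
    (t : Edge d → Ω → ℝ) (v : Fin d → ℤ) (e : Edge d) : ℝ≥0∞ :=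
  P {ω | e ∈ geodesicEdges (fun e' => t e' ω) 0 v}

/-- Smoothness of `q` in the logarithmic scale: `0.1 ≤ q_e / q_{e'} ≤ 10` whenever
`‖e - e'‖ ≤ 2 log n`, written without division. -/
def IsLogSmooth {d : ℕ} (n : ℝ) (q : Edge d → ℝ≥0) : Prop :=
  ∀ e e' : Edge d, edgeDist e e' ≤ 2 * Real.log n →
    (1 / 10) * q e' ≤ q e ∧ q e ≤ 10 * q e'

end FPP

/-! The proof raises every weight `t e` slightly, by an amount of order `δ * q e` with `δ = 1 / (2 *
D)` and `D ^ 2 = ∑ q e ^ 2`, and compares geodesics before and after. A single weight can be moved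
this way at second-order cost in the density (`exists_site_shift`). Hence the product density `W` of
the original law relative to the shifted one has third moment at most 2
(`lintegral_shift_infinitePi`, `lintegral_prod_pow_infinitePi`).

Let `N` be the `q`-weight of the geodesic from `0` to `v` in the raised environment. Raising the
weights lengthens this path by at least a constant times `δ * N`: few weights resist the shift, and
log-smoothness of `q` prevents the resistant edges from carrying most of the weight
(`sum_walkEdges_le_sum_good`). The geodesic from `u` to `v + u` in the original environment must
lengthen by almost as much, up to an error of order `|u|`, and its lengthening is at most a constant
times `δ` times its own `q`-weight (`weight_le_weight_translate`). So `N ≥ s` forces weight of order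
`s` on the geodesics of all translates `u` in a box of side `R` of order `δ * s`.

On the other hand, a geodesic has only `O(R)` edges in such a box, so by translation invariance the
expected weights summed over the box are `O(R) * ∑ q` (`sum_lintegral_geodesicWeight_le`). Dividing
by the `R ^ d` translates gives `P(N ≥ s) ≤ C * ∑ q * D ^ (d - 1) / s ^ d` away from a rare event
(`weak_type_bound`). The required expectation is the integral of `N * W`; since `d ≥ 2`, the tail of
`N` is at least weakly square integrable, which pairs with the third moment of `W`
(`lintegral_mul_le_of_weak_type`). -/

namespace FPP

/-! ### Shifting a single weight at second-order cost -/

/-- An increasing map `φ` of the weights, of size at most `A τ`, under which `G` is transported to a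
comparable law: `w` is the density of `G` with respect to the law of `φ(t)`, evaluated at `φ(t)`. -/
structure IsSiteShift (G : Measure ℝ) (a b A τ : ℝ) (φ : ℝ → ℝ) (w : ℝ → ℝ≥0∞) : Prop where
  measurable_map : Measurable φ
  measurable_density : Measurable w
  density_ne_zero : ∀ t, w t ≠ 0
  le_map : ∀ t, t ≤ φ t ∧ φ t ≤ t + A * τ
  map_mem : ∀ t ∈ Set.Icc a b, φ t ∈ Set.Icc a b
  lintegral_eq : ∀ g : ℝ → ℝ≥0∞, Measurable g → ∫⁻ t, g t ∂G = ∫⁻ t, g (φ t) * w t ∂G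
  lintegral_cube_le : ∫⁻ t, w t ^ 3 ∂G ≤ ENNReal.ofReal (1 + τ ^ 2)

/-- For `G`-almost every `t` the distribution function has linear growth to the right of `t`. -/
lemma ae_exists_cdf_sub_le {G : Measure ℝ} (hG : G ≪ volume) :
    ∀ᵐ t ∂G, ∃ K : ℕ, ∀ y, t ≤ y → cdf G y - cdf G t ≤ K * (y - t) := by
  filter_upwards [hG.ae_le (monotone_cdf G).ae_differentiableAt] with t ht
  obtain ⟨C, hC⟩ := ht.hasDerivAt.isBigO_sub.bound
  obtain ⟨δ, hδ, hb⟩ := Metric.eventually_nhds_iff.1 hC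
  -- The derivative bound `C` serves within distance `δ`; beyond it the increment is at most 1, so
  -- `1 / δ` suffices.
  obtain ⟨K, hK⟩ := exists_nat_ge (max C (1 / δ))
  refine ⟨K, fun y hy => ?_⟩
  rcases lt_or_ge (y - t) δ with h | h
  · have := hb (y := y) (by rw [Real.dist_eq, abs_of_nonneg (by linarith)]; exact h)
    rw [Real.norm_eq_abs, Real.norm_eq_abs, abs_of_nonneg (sub_nonneg.2 hy)] at this
    refine (le_abs_self _).trans (this.trans ?_)
    exact mul_le_mul_of_nonneg_right ((le_max_left _ _).trans hK) (by linarith)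
  · have h1 : cdf G y - cdf G t ≤ 1 := by linarith [cdf_le_one G y, cdf_nonneg G t]
    have h2 : (1 / δ) * δ ≤ K * (y - t) :=
      mul_le_mul ((le_max_right _ _).trans hK) h hδ.le (Nat.cast_nonneg _)
    rw [one_div_mul_cancel hδ.ne'] at h2
    linarith

section SiteShift

variable {G : Measure ℝ} [IsProbabilityMeasure G] {a b α : ℝ}

/-- The image of `G` under its distribution function, if continuous and strictly increasing on the
support, is the uniform law on `[0, 1]`. -/
lemma map_cdf_eq_volume (hab : a < b) (hsupp : G (Set.Icc a b)ᶜ = 0)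
    (hcont : Continuous (cdf G)) (hmono : StrictMonoOn (cdf G) (Set.Icc a b))
    (h0 : cdf G a = 0) (h1 : cdf G b = 1) :
    G.map (cdf G) = (volume : Measure ℝ).restrict (Set.Icc 0 1) := by
  have : IsProbabilityMeasure (G.map (cdf G)) :=
    Measure.isProbabilityMeasure_map hcont.measurable.aemeasurable
  refine Measure.ext_of_Iic _ _ fun u => ?_
  rw [Measure.map_apply hcont.measurable measurableSet_Iic,
    Measure.restrict_apply measurableSet_Iic]
  rcases lt_or_ge u 0 with hu | hu
  · have e1 : (cdf G) ⁻¹' Set.Iic u = ∅ := by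
      ext t
      simpa using lt_of_lt_of_le hu (cdf_nonneg G t)
    have e2 : Set.Iic u ∩ Set.Icc (0 : ℝ) 1 = ∅ := by
      ext t
      simp only [Set.mem_inter_iff, Set.mem_Iic, Set.mem_Icc, Set.mem_empty_iff_false, iff_false]
      rintro ⟨h, h', -⟩
      linarith
    rw [e1, e2]; simp
  rcases le_or_gt 1 u with hu1 | hu1
  · have e1 : (cdf G) ⁻¹' Set.Iic u = Set.univ := by
      ext t
      simpa using (cdf_le_one G t).trans hu1
    have e2 : Set.Iic u ∩ Set.Icc (0 : ℝ) 1 = Set.Icc 0 1 := by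
      ext t
      simp only [Set.mem_inter_iff, Set.mem_Iic, Set.mem_Icc, and_iff_right_iff_imp]
      rintro ⟨h, h'⟩
      linarith
    rw [e1, e2]; simp
  obtain ⟨t, ht, htu⟩ := intermediate_value_Icc hab.le hcont.continuousOn
    (show u ∈ Set.Icc (cdf G a) (cdf G b) by rw [h0, h1]; exact ⟨hu, hu1.le⟩)
  -- The two sets agree only on `[a, b]`, where the distribution function is injective; this is
  -- enough up to a null set.
  have e1 : G ((cdf G) ⁻¹' Set.Iic u) = G (Set.Iic t) := by
    refine measure_congr ?_
    have : ∀ᵐ s ∂G, s ∈ Set.Icc a b := by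
      rw [ae_iff]; exact hsupp
    filter_upwards [this] with s hs
    refine propext ?_
    change cdf G s ≤ u ↔ s ≤ t
    rw [← htu]
    exact hmono.le_iff_le hs ht
  have e2 : Set.Iic u ∩ Set.Icc (0 : ℝ) 1 = Set.Icc 0 u := by
    ext s
    simp only [Set.mem_inter_iff, Set.mem_Iic, Set.mem_Icc]
    constructor
    · rintro ⟨h, h', -⟩; exact ⟨h', h⟩
    · rintro ⟨h, h'⟩; exact ⟨h', h, by linarith⟩
  rw [e1, e2, Real.volume_Icc, sub_zero, ← htu, ofReal_cdf]

/-- The bump reparametrization `u ↦ u + τ u (1 - u)` of `[0, 1]` and its derivative. -/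
lemma lintegral_bump {τ : ℝ} (h0 : 0 ≤ τ) (h1 : τ ≤ 1 / 2) (g : ℝ → ℝ≥0∞) :
    ∫⁻ u in Set.Icc (0 : ℝ) 1, g u =
      ∫⁻ u in Set.Icc (0 : ℝ) 1,
        ENNReal.ofReal (1 + τ * (1 - 2 * u)) * g (u + τ * u * (1 - u)) := by
  have hd : ∀ u ∈ Set.Icc (0 : ℝ) 1,
      HasDerivWithinAt (fun u : ℝ => u + τ * u * (1 - u)) (1 + τ * (1 - 2 * u))
        (Set.Icc 0 1) u := by
    intro u _
    have h := ((hasDerivAt_id u).add (((hasDerivAt_id u).const_mul τ).mul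
      ((hasDerivAt_id u).const_sub 1)))
    refine (h.congr_deriv ?_).hasDerivWithinAt
    simp; ring
  have hs : StrictMonoOn (fun u : ℝ => u + τ * u * (1 - u)) (Set.Icc 0 1) := by
    intro x hx y hy hxy
    -- This product is the exact increment of the bump map from `x` to `y`.
    have : 0 < (y - x) * (1 + τ * (1 - x - y)) := by
      apply mul_pos (by linarith)
      nlinarith [hx.1, hx.2, hy.1, hy.2]
    show x + τ * x * (1 - x) < y + τ * y * (1 - y)
    nlinarith
  have him : (fun u : ℝ => u + τ * u * (1 - u)) '' Set.Icc 0 1 = Set.Icc 0 1 := by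
    refine Set.Subset.antisymm ?_ ?_
    · rintro _ ⟨u, hu, rfl⟩
      have h2 : 0 ≤ u * (1 - u) := mul_nonneg hu.1 (by linarith [hu.2])
      constructor
      · show 0 ≤ u + τ * u * (1 - u)
        nlinarith [hu.1]
      · show u + τ * u * (1 - u) ≤ 1
        nlinarith [hu.1, hu.2, mul_nonneg h0 h2]
    · have := intermediate_value_Icc (zero_le_one' ℝ)
        (f := fun u : ℝ => u + τ * u * (1 - u)) (by fun_prop)
      simpa using this
  have key := lintegral_image_eq_lintegral_abs_deriv_mul measurableSet_Icc hd hs.injOn g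
  rw [him] at key
  rw [key]
  refine setLIntegral_congr_fun measurableSet_Icc fun u hu => ?_
  rw [abs_of_nonneg]
  nlinarith [hu.1, hu.2]

/-- The odd powers of `1 - 2 * u` integrate to zero and its square to `1 / 3`, so no term linear in
`τ` survives. This is why the cost of shifting all edges is governed by a sum of squares. -/
lemma lintegral_bump_cube {τ : ℝ} (h0 : 0 ≤ τ) (h1 : τ ≤ 1 / 2) :
    ∫⁻ u in Set.Icc (0 : ℝ) 1, ENNReal.ofReal (1 + τ * (1 - 2 * u)) ^ 3 =
      ENNReal.ofReal (1 + τ ^ 2) := by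
  have e : ∀ u ∈ Set.Icc (0 : ℝ) 1, ENNReal.ofReal (1 + τ * (1 - 2 * u)) ^ 3 =
      ENNReal.ofReal ((1 + τ * (1 - 2 * u)) ^ 3) := by
    intro u hu
    rw [ENNReal.ofReal_pow]
    nlinarith [hu.1, hu.2]
  rw [setLIntegral_congr_fun measurableSet_Icc e, ← ofReal_integral_eq_lintegral_ofReal]
  · congr 1
    rw [integral_Icc_eq_integral_Ioc, ← intervalIntegral.integral_of_le zero_le_one]
    have hd : ∀ u ∈ Set.uIcc (0 : ℝ) 1, HasDerivAt
        (fun u : ℝ => (1 + τ) ^ 3 * u - 3 * (1 + τ) ^ 2 * τ * u ^ 2 + 4 * (1 + τ) * τ ^ 2 * u ^ 3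
          - 2 * τ ^ 3 * u ^ 4) ((1 + τ * (1 - 2 * u)) ^ 3) u := by
      intro u _
      have h := ((((hasDerivAt_id u).const_mul ((1 + τ) ^ 3)).sub
        ((hasDerivAt_pow 2 u).const_mul (3 * (1 + τ) ^ 2 * τ))).add
        ((hasDerivAt_pow 3 u).const_mul (4 * (1 + τ) * τ ^ 2))).sub
        ((hasDerivAt_pow 4 u).const_mul (2 * τ ^ 3))
      refine h.congr_deriv ?_
      simp; ring
    rw [intervalIntegral.integral_eq_sub_of_hasDerivAt hd]
    · ring
    · exact Continuous.intervalIntegrable (by fun_prop) _ _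
  · exact Continuous.integrableOn_Icc (by fun_prop)
  · refine (ae_restrict_iff' measurableSet_Icc).2 (Filter.Eventually.of_forall fun u hu => ?_)
    have : 0 ≤ 1 + τ * (1 - 2 * u) := by nlinarith [hu.1, hu.2]
    positivity

lemma continuous_cdf [NullSingletonClass G] : Continuous (cdf G) := by
  refine continuous_iff_continuousAt.2 fun x => ?_
  rw [(monotone_cdf G).continuousAt_iff_leftLim_eq_rightLim, StieltjesFunction.rightLim_eq]
  have h := (cdf G).measure_singleton x
  rw [measure_cdf, measure_singleton] at h
  have h1 := ENNReal.ofReal_eq_zero.1 h.symm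
  have h2 := (monotone_cdf G).leftLim_le (le_refl x)
  linarith

lemma mul_sub_le_cdf_sub {ρ : ℝ → ℝ≥0∞} (hG : G = (volume : Measure ℝ).withDensity ρ)
    (hρ : ∀ᵐ x ∂(volume : Measure ℝ), x ∈ Set.Icc a b → ENNReal.ofReal α ≤ ρ x)
    {x y : ℝ} (hx : a ≤ x) (hxy : x ≤ y) (hy : y ≤ b) :
    α * (y - x) ≤ cdf G y - cdf G x := by
  have h := (cdf G).measure_Ioc x y
  rw [measure_cdf] at h
  have h2 : ENNReal.ofReal (α * (y - x)) ≤ G (Set.Ioc x y) := by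
    rw [hG, withDensity_apply _ measurableSet_Ioc]
    calc ENNReal.ofReal (α * (y - x)) = ∫⁻ _ in Set.Ioc x y, ENNReal.ofReal α := by
          rw [lintegral_const, Measure.restrict_apply_univ, Real.volume_Ioc,
            ENNReal.ofReal_mul' (by linarith)]
      _ ≤ ∫⁻ s in Set.Ioc x y, ρ s := by
          refine lintegral_mono_ae ((ae_restrict_iff' measurableSet_Ioc).2 ?_)
          filter_upwards [hρ] with s hs hs2
          exact hs ⟨hx.trans hs2.1.le, hs2.2.trans hy⟩
  rw [h] at h2
  exact (ENNReal.ofReal_le_ofReal_iff (sub_nonneg.2 (monotone_cdf G hxy))).1 h2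

/-- Up to an exceptional set of small probability, the distribution function of an absolutely
continuous law has linear growth to the right and is bounded away from `0` and `1`. -/
lemma exists_small_exceptional_set (hG : G ≪ volume) (hcont : Continuous (cdf G))
    (hpos : ∀ᵐ t ∂G, 0 < cdf G t ∧ cdf G t < 1) {ε : ℝ≥0∞} (hε : 0 < ε) :
    ∃ (K : ℕ) (B : Set ℝ), 0 < K ∧ MeasurableSet B ∧ G B ≤ ε ∧ ∀ t ∉ B,
      (∀ y, t ≤ y → cdf G y - cdf G t ≤ K * (y - t)) ∧ 1 / (K : ℝ) ≤ cdf G t * (1 - cdf G t) := by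
  -- Restricting `y` to rationals makes the set measurable; all real `y` are recovered at the end.
  let S : ℕ → Set ℝ := fun K => {t | ∀ y : ℚ, t ≤ y → cdf G y - cdf G t ≤ K * (y - t)} ∩
    {t | 1 / (K : ℝ) ≤ cdf G t * (1 - cdf G t)}
  have hSm : ∀ K, MeasurableSet (S K) := by
    intro K
    refine MeasurableSet.inter ?_ (measurableSet_le (by fun_prop) (by fun_prop))
    rw [Set.ofPred_forall]
    refine MeasurableSet.iInter fun y => ?_
    have : {t : ℝ | t ≤ y → cdf G y - cdf G t ≤ K * (y - t)} =
        {t : ℝ | t ≤ y}ᶜ ∪ {t : ℝ | cdf G y - cdf G t ≤ K * (y - t)} := by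
      ext t; simp [imp_iff_not_or]
    rw [this]
    exact (measurableSet_le (by fun_prop) (by fun_prop)).compl.union
      (measurableSet_le (by fun_prop) (by fun_prop))
  -- The index `j + 1` avoids the junk value of `1 / 0`, and intersecting over `j ≤ K` makes the
  -- sequence decreasing by construction.
  let B : ℕ → Set ℝ := fun K => ⋂ j ≤ K, (S (j + 1))ᶜ
  have hBm : ∀ K, MeasurableSet (B K) := fun K =>
    MeasurableSet.iInter fun j => MeasurableSet.iInter fun _ => (hSm _).compl
  have hanti : Antitone B := by
    intro K K' hKK t ht
    simp only [B, Set.mem_iInter] at ht ⊢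
    exact fun j hj => ht j (hj.trans hKK)
  have hlim := tendsto_measure_iInter_atTop (μ := G) (fun K => (hBm K).nullMeasurableSet) hanti
    ⟨0, measure_ne_top _ _⟩
  have hnull : G (⋂ K, B K) = 0 := by
    have : ∀ᵐ t ∂G, ¬ t ∈ ⋂ K, B K := by
      filter_upwards [ae_exists_cdf_sub_le hG, hpos] with t ⟨K, hK⟩ hp
      obtain ⟨K', hK'⟩ := exists_nat_gt (1 / (cdf G t * (1 - cdf G t)))
      have hpp : 0 < cdf G t * (1 - cdf G t) := mul_pos hp.1 (by linarith [hp.2])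
      intro hmem
      have h1 : t ∈ (S (max K K' + 1))ᶜ := by
        have := Set.mem_iInter.1 hmem (max K K')
        simp only [B, Set.mem_iInter] at this
        exact this _ le_rfl
      refine h1 ⟨fun y hy => (hK y hy).trans ?_, ?_⟩
      · refine mul_le_mul_of_nonneg_right ?_ (by linarith)
        exact_mod_cast (le_max_left K K').trans (Nat.le_succ _)
      · show 1 / ((max K K' + 1 : ℕ) : ℝ) ≤ _
        have h3 : (K' : ℝ) ≤ ((max K K' + 1 : ℕ) : ℝ) := by
          exact_mod_cast (le_max_right K K').trans (Nat.le_succ _)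
        rw [div_le_iff₀ (by positivity)]
        rw [div_lt_iff₀ hpp] at hK'
        nlinarith
    rw [ae_iff] at this
    simpa only [not_not, Set.ofPred_mem_eq] using this
  rw [hnull] at hlim
  obtain ⟨K, hK⟩ := (hlim.eventually (gt_mem_nhds hε)).exists
  have hmonoS : ∀ j ≤ K, S (j + 1) ⊆ S (K + 1) := by
    rintro j hj t ⟨h1, h2⟩
    have hjK : ((j + 1 : ℕ) : ℝ) ≤ ((K + 1 : ℕ) : ℝ) := by exact_mod_cast Nat.succ_le_succ hj
    refine ⟨fun y hy => (h1 y hy).trans ?_, ?_⟩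
    · exact mul_le_mul_of_nonneg_right hjK (by linarith)
    · refine le_trans ?_ (show 1 / ((j + 1 : ℕ) : ℝ) ≤ cdf G t * (1 - cdf G t) from h2)
      exact one_div_le_one_div_of_le (by positivity) hjK
  refine ⟨K + 1, B K, Nat.succ_pos _, hBm K, hK.le, fun t ht => ?_⟩
  have ht' : t ∈ S (K + 1) := by
    simp only [B, Set.mem_iInter, Set.mem_compl_iff, not_forall, not_not] at ht
    obtain ⟨j, hj, h⟩ := ht
    exact hmonoS j hj h
  refine ⟨fun y hy => ?_, ht'.2⟩
  -- A violation at `y` is strict, so by monotonicity it persists at a rational slightly to the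
  -- right of `y`.
  by_contra! hlt
  have hK0 : (0 : ℝ) < ((K + 1 : ℕ) : ℝ) := by positivity
  obtain ⟨r, hr1, hr2⟩ := exists_rat_btwn
    (show y < t + (cdf G y - cdf G t) / ((K + 1 : ℕ) : ℝ) by
      rw [← sub_lt_iff_lt_add', lt_div_iff₀ hK0]; linarith)
  have h3 := ht'.1 r (hy.trans hr1.le)
  have h4 := monotone_cdf G hr1.le
  rw [← sub_lt_iff_lt_add', lt_div_iff₀ hK0] at hr2
  linarith

/-- A family of increasing shifts of the single weights: the shifted law `φ_τ(t)` is comparable to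
`G`, the shift is at most of order `τ`, and of order `τ` with probability as close to one as
desired. -/
theorem exists_site_shift (hab : a < b) (hα : 0 < α) (hsupp : G (Set.Icc a b)ᶜ = 0)
    {ρ : ℝ → ℝ≥0∞} (hG : G = (volume : Measure ℝ).withDensity ρ)
    (hρ : ∀ᵐ x ∂(volume : Measure ℝ), x ∈ Set.Icc a b → ENNReal.ofReal α ≤ ρ x) :
    ∃ (φ : ℝ → ℝ → ℝ) (w : ℝ → ℝ → ℝ≥0∞) (A : ℝ), 0 < A ∧
      (∀ τ, 0 ≤ τ → τ ≤ 1 / 2 → IsSiteShift G a b A τ (φ τ) (w τ)) ∧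
      ∀ ε : ℝ≥0∞, 0 < ε → ∃ (κ : ℝ) (B : Set ℝ), 0 < κ ∧ MeasurableSet B ∧ G B ≤ ε ∧
        ∀ τ, 0 ≤ τ → τ ≤ 1 / 2 → ∀ t ∉ B, t + κ * τ ≤ φ τ t := by
  have hac : G ≪ volume := hG ▸ withDensity_absolutelyContinuous _ _
  have hna : NullSingletonClass G := ⟨fun x => hac (by simp)⟩
  have hcont : Continuous (cdf G) := continuous_cdf
  have hlow : ∀ {x y : ℝ}, a ≤ x → x ≤ y → y ≤ b → α * (y - x) ≤ cdf G y - cdf G x :=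
    fun h1 h2 h3 => mul_sub_le_cdf_sub hG hρ h1 h2 h3
  have hmono : StrictMonoOn (cdf G) (Set.Icc a b) := by
    intro x hx y hy hxy
    have := hlow hx.1 hxy.le hy.2
    nlinarith
  have hsa : G (Set.Iic a) = 0 := by
    refine measure_mono_null (t := (Set.Icc a b)ᶜ ∪ {a}) ?_ (measure_union_null hsupp (measure_singleton a))
    intro x hx
    rcases eq_or_lt_of_le (show x ≤ a from hx) with h | h
    · exact Or.inr h
    · exact Or.inl fun hh => absurd hh.1 (not_le.2 h)
  have h0 : cdf G a = 0 := by
    rw [cdf_eq_real, Measure.real, hsa, ENNReal.toReal_zero]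
  have h1 : cdf G b = 1 := by
    have : G (Set.Iic b) = 1 := by
      refine (prob_compl_eq_zero_iff measurableSet_Iic).1 (measure_mono_null ?_ hsupp)
      intro x hx hh
      exact hx hh.2
    rw [cdf_eq_real, Measure.real, this, ENNReal.toReal_one]
  -- Clipping `u` to `[0, 1]` makes the quantile function `r` total and monotone, hence measurable.
  have hex : ∀ u : ℝ, ∃ t ∈ Set.Icc a b, cdf G t = max 0 (min u 1) := fun u =>
    intermediate_value_Icc hab.le hcont.continuousOn
      (by rw [h0, h1]; exact ⟨le_max_left _ _, max_le zero_le_one (min_le_right _ _)⟩)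
  choose r hr hFr using hex
  have hrmono : Monotone r := by
    intro u u' huu
    rw [← hmono.le_iff_le (hr u) (hr u'), hFr, hFr]
    gcongr
  have hFr' : ∀ u ∈ Set.Icc (0 : ℝ) 1, cdf G (r u) = u := fun u hu => by
    rw [hFr, min_eq_left hu.2, max_eq_right hu.1]
  have hrF : ∀ t ∈ Set.Icc a b, r (cdf G t) = t := fun t ht =>
    hmono.injOn (hr _) ht (hFr' _ ⟨cdf_nonneg G t, cdf_le_one G t⟩)
  have hae : ∀ᵐ t ∂G, t ∈ Set.Icc a b := by rw [ae_iff]; exact hsupp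
  have hFmeas : Measurable (cdf G) := hcont.measurable
  have hint : ∀ g : ℝ → ℝ≥0∞, Measurable g →
      ∫⁻ t, g (cdf G t) ∂G = ∫⁻ u in Set.Icc (0 : ℝ) 1, g u := fun g hg => by
    rw [← map_cdf_eq_volume hab hsupp hcont hmono h0 h1, lintegral_map hg hFmeas]
  let ψ : ℝ → ℝ → ℝ := fun τ u => u + τ * u * (1 - u)
  have hψ : ∀ τ, 0 ≤ τ → τ ≤ 1 / 2 → ∀ u ∈ Set.Icc (0 : ℝ) 1, ψ τ u ∈ Set.Icc (0 : ℝ) 1 := by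
    intro τ hτ hτ' u hu
    have h2 : 0 ≤ u * (1 - u) := mul_nonneg hu.1 (by linarith [hu.2])
    constructor
    · show 0 ≤ u + τ * u * (1 - u)
      nlinarith [hu.1]
    · show u + τ * u * (1 - u) ≤ 1
      nlinarith [hu.1, hu.2, mul_nonneg hτ h2]
  classical
  -- On `[a, b]` this is the bump map conjugated by the distribution function, which carries `G` to
  -- the uniform law; the density is then the derivative of the bump.
  let φ : ℝ → ℝ → ℝ := fun τ t => if t ∈ Set.Icc a b then r (ψ τ (cdf G t)) else t
  have hψF : ∀ τ, 0 ≤ τ → τ ≤ 1 / 2 → ∀ t, cdf G (r (ψ τ (cdf G t))) = ψ τ (cdf G t) :=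
    fun τ hτ hτ' t => hFr' _ (hψ τ hτ hτ' _ ⟨cdf_nonneg G t, cdf_le_one G t⟩)
  have hle : ∀ τ, 0 ≤ τ → τ ≤ 1 / 2 → ∀ t, t ≤ φ τ t := by
    intro τ hτ hτ' t
    by_cases ht : t ∈ Set.Icc a b
    · simp only [φ, if_pos ht]
      rw [← hmono.le_iff_le ht (hr _), hψF τ hτ hτ']
      have := mul_nonneg hτ (mul_nonneg (cdf_nonneg G t) (sub_nonneg.2 (cdf_le_one G t)))
      show cdf G t ≤ cdf G t + τ * cdf G t * (1 - cdf G t)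
      nlinarith
    · simp only [φ, if_neg ht, le_refl]
  -- `A = 1 / α`: the distribution function gains at most `τ` and has slope at least `α` on `[a,
  -- b]`.
  refine ⟨φ, fun τ t => ENNReal.ofReal (1 + τ * (1 - 2 * cdf G t)), 1 / α, by positivity,
    fun τ hτ hτ' => ⟨?_, by fun_prop, ?_, fun t => ⟨hle τ hτ hτ' t, ?_⟩, ?_, ?_, ?_⟩, ?_⟩
  · refine Measurable.ite measurableSet_Icc (hrmono.measurable.comp ?_) measurable_id
    show Measurable fun t => cdf G t + τ * cdf G t * (1 - cdf G t)
    fun_prop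
  · intro t
    simp only [ne_eq, ENNReal.ofReal_eq_zero, not_le]
    nlinarith [cdf_nonneg G t, cdf_le_one G t]
  · by_cases ht : t ∈ Set.Icc a b
    · have h2 := hle τ hτ hτ' t
      simp only [φ, if_pos ht] at h2 ⊢
      have h3 := hlow ht.1 h2 (hr _).2
      rw [hψF τ hτ hτ'] at h3
      have h4 : ψ τ (cdf G t) - cdf G t ≤ τ := by
        show cdf G t + τ * cdf G t * (1 - cdf G t) - cdf G t ≤ τ
        have h5 : cdf G t * (1 - cdf G t) ≤ 1 := by
          nlinarith [cdf_nonneg G t, cdf_le_one G t]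
        nlinarith
      have h5 : r (ψ τ (cdf G t)) - t ≤ 1 / α * τ := by
        rw [one_div, ← div_eq_inv_mul, le_div_iff₀ hα]
        linarith
      linarith
    · simp only [φ, if_neg ht]
      have : 0 ≤ 1 / α * τ := by positivity
      linarith
  · intro t ht
    simp only [φ, if_pos ht]
    exact hr _
  · intro g hg
    have e1 : ∫⁻ t, g t ∂G = ∫⁻ t, g (r (cdf G t)) ∂G := by
      refine lintegral_congr_ae ?_
      filter_upwards [hae] with t ht
      rw [hrF t ht]
    have e2 : ∫⁻ t, g (φ τ t) * ENNReal.ofReal (1 + τ * (1 - 2 * cdf G t)) ∂G =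
        ∫⁻ t, ENNReal.ofReal (1 + τ * (1 - 2 * cdf G t)) * g (r (ψ τ (cdf G t))) ∂G := by
      refine lintegral_congr_ae ?_
      filter_upwards [hae] with t ht
      simp only [φ, if_pos ht, mul_comm]
    have hrm := hrmono.measurable
    rw [e1, e2, hint (fun u => g (r u)) (hg.comp hrm),
      hint (fun u => ENNReal.ofReal (1 + τ * (1 - 2 * u)) * g (r (ψ τ u)))]
    · exact lintegral_bump hτ hτ' _
    · refine Measurable.mul (by fun_prop) (hg.comp (hrm.comp ?_))
      show Measurable fun u : ℝ => u + τ * u * (1 - u)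
      fun_prop
  · rw [hint (fun u => ENNReal.ofReal (1 + τ * (1 - 2 * u)) ^ 3) (by fun_prop)]
    exact (lintegral_bump_cube hτ hτ').le
  · intro ε hε
    have hpos : ∀ᵐ t ∂G, 0 < cdf G t ∧ cdf G t < 1 := by
      have hna' : ∀ᵐ t ∂G, t ≠ a ∧ t ≠ b := by
        have ha : ∀ᵐ t ∂G, t ≠ a := by
          rw [ae_iff]; simp
        have hb : ∀ᵐ t ∂G, t ≠ b := by
          rw [ae_iff]; simp
        exact ha.and hb
      filter_upwards [hae, hna'] with t ht ht'
      rw [← h0, ← h1]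
      exact ⟨hmono ⟨le_rfl, hab.le⟩ ht (lt_of_le_of_ne ht.1 ht'.1.symm),
        hmono ht ⟨hab.le, le_rfl⟩ (lt_of_le_of_ne ht.2 ht'.2)⟩
    obtain ⟨K, B, hK, hBm, hB, hgood⟩ := exists_small_exceptional_set hac hcont hpos hε
    -- Off `B` the bump gains at least `τ / K`, and growth of the distribution function at rate at
    -- most `K` turns this into a displacement of at least `τ / K ^ 2`.
    refine ⟨1 / K * (1 / K), B ∪ (Set.Icc a b)ᶜ, by positivity,
      hBm.union measurableSet_Icc.compl, ?_, fun τ hτ hτ' t ht => ?_⟩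
    · exact (measure_union_le _ _).trans (by rw [hsupp, add_zero]; exact hB)
    · simp only [Set.mem_union, Set.mem_compl_iff, not_or, not_not] at ht
      obtain ⟨g1, g2⟩ := hgood t ht.1
      have h3 := g1 (φ τ t) (hle τ hτ hτ' t)
      simp only [φ, if_pos ht.2] at h3 ⊢
      rw [hψF τ hτ hτ'] at h3
      have hK0 : (0 : ℝ) < K := by exact_mod_cast hK
      have h4 : τ * (1 / K) ≤ ψ τ (cdf G t) - cdf G t := by
        show τ * (1 / K) ≤ cdf G t + τ * cdf G t * (1 - cdf G t) - cdf G t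
        nlinarith
      have h5 : 1 / K * (τ * (1 / K)) ≤ r (ψ τ (cdf G t)) - t := by
        rw [one_div_mul_eq_div, div_le_iff₀ hK0]
        linarith
      linarith

end SiteShift

/-! ### Change of variables in the product law -/

section Product

variable {ι : Type*} [DecidableEq ι] (G : Measure ℝ) [IsProbabilityMeasure G]

lemma measurable_update_pair (i : ι) :
    Measurable fun z : (ι → ℝ) × ℝ => Function.update z.1 i z.2 := by
  refine measurable_pi_iff.2 fun j => ?_
  rcases eq_or_ne j i with rfl | h
  · simpa using measurable_snd
  · simp only [Function.update_of_ne h]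
    exact (measurable_pi_apply j).comp measurable_fst

/-- Resampling one coordinate does not change the product law. -/
lemma map_update_infinitePi (i : ι) :
    ((Measure.infinitePi fun _ : ι => G).prod G).map
      (fun z : (ι → ℝ) × ℝ => Function.update z.1 i z.2) = Measure.infinitePi fun _ : ι => G := by
  refine Measure.eq_infinitePi _ fun s t ht => ?_
  rw [Measure.map_apply (measurable_update_pair i) (.pi s.countable_toSet fun _ _ => ht _)]
  have hpre : (fun z : (ι → ℝ) × ℝ => Function.update z.1 i z.2) ⁻¹' (s : Set ι).pi t =
      ((s.erase i : Finset ι) : Set ι).pi t ×ˢ (if i ∈ s then t i else Set.univ) := by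
    ext z
    simp only [Set.mem_preimage, Set.mem_pi, Finset.mem_coe, Set.mem_prod, Finset.mem_erase]
    constructor
    · intro h
      refine ⟨fun j hj => by simpa [hj.1] using h j hj.2, ?_⟩
      split_ifs with hi
      · simpa using h i hi
      · trivial
    · rintro ⟨h1, h2⟩ j hj
      rcases eq_or_ne j i with rfl | h
      · simpa [hj] using h2
      · simpa [h] using h1 j ⟨h, hj⟩
  rw [hpre, Measure.prod_prod, Measure.infinitePi_pi _ fun j _ => ht j]
  split_ifs with hi
  · rw [mul_comm, Finset.mul_prod_erase s (fun j => G (t j)) hi]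
  · rw [measure_univ, mul_one, Finset.erase_eq_of_notMem hi]

lemma lintegral_update_infinitePi (i : ι) {f : (ι → ℝ) → ℝ≥0∞} (hf : Measurable f) :
    ∫⁻ U, f U ∂(Measure.infinitePi fun _ : ι => G) =
      ∫⁻ U, ∫⁻ x, f (Function.update U i x) ∂G ∂(Measure.infinitePi fun _ : ι => G) := by
  conv_lhs => rw [← map_update_infinitePi G i]
  rw [lintegral_map hf (measurable_update_pair i), lintegral_prod
    (fun z : (ι → ℝ) × ℝ => f (Function.update z.1 i z.2))
    (hf.comp (measurable_update_pair i)).aemeasurable]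

/-- The change of variables formula for a shift of finitely many coordinates. -/
theorem lintegral_shift_infinitePi (φ : ι → ℝ → ℝ) (w : ι → ℝ → ℝ≥0∞)
    (hφ : ∀ i, Measurable (φ i)) (hw : ∀ i, Measurable (w i))
    (h : ∀ i, ∀ g : ℝ → ℝ≥0∞, Measurable g → ∫⁻ t, g t ∂G = ∫⁻ t, g (φ i t) * w i t ∂G)
    (s : Finset ι) {f : (ι → ℝ) → ℝ≥0∞} (hf : Measurable f) :
    ∫⁻ U, f U ∂(Measure.infinitePi fun _ : ι => G) =
      ∫⁻ U, f (fun i => if i ∈ s then φ i (U i) else U i) * ∏ i ∈ s, w i (U i)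
        ∂(Measure.infinitePi fun _ : ι => G) := by
  induction s using Finset.induction_on with
  | empty => simp
  | insert i s hi ih =>
    have hm : ∀ s : Finset ι, Measurable fun U : ι → ℝ => fun i => if i ∈ s then φ i (U i) else U i := by
      intro s
      refine measurable_pi_iff.2 fun j => ?_
      split_ifs
      · exact (hφ j).comp (measurable_pi_apply j)
      · exact measurable_pi_apply j
    have hp : ∀ s : Finset ι, Measurable fun U : ι → ℝ => ∏ i ∈ s, w i (U i) := fun s =>
      Finset.measurable_prod _ fun j _ => (hw j).comp (measurable_pi_apply j)
    have hfp : ∀ s : Finset ι, Measurable fun U : ι → ℝ =>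
        f (fun i => if i ∈ s then φ i (U i) else U i) * ∏ i ∈ s, w i (U i) := fun s =>
      (hf.comp (hm s)).mul (hp s)
    -- Both sides are resampled at `i`; with the other coordinates frozen, the one-coordinate
    -- formula applies inside.
    rw [ih, lintegral_update_infinitePi G i (hfp s), lintegral_update_infinitePi G i (hfp _)]
    refine lintegral_congr fun U => ?_
    have e1 : ∀ x, (fun j => if j ∈ s then φ j (Function.update U i x j) else Function.update U i x j)
        = Function.update (fun j => if j ∈ s then φ j (U j) else U j) i x := by
      intro x
      ext j
      rcases eq_or_ne j i with rfl | h
      · simp [hi]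
      · simp [h]
    have e2 : ∀ x, (fun j => if j ∈ insert i s then φ j (Function.update U i x j)
        else Function.update U i x j)
        = Function.update (fun j => if j ∈ s then φ j (U j) else U j) i (φ i x) := by
      intro x
      ext j
      rcases eq_or_ne j i with rfl | h
      · simp
      · simp [h]
    have e3 : ∀ x, ∏ j ∈ s, w j (Function.update U i x j) = ∏ j ∈ s, w j (U j) := fun x =>
      Finset.prod_congr rfl fun j hj => by
        rw [Function.update_of_ne (ne_of_mem_of_not_mem hj hi)]
    have e4 : ∀ x, ∏ j ∈ insert i s, w j (Function.update U i x j) =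
        w i x * ∏ j ∈ s, w j (U j) := fun x => by
      rw [Finset.prod_insert hi, e3, Function.update_self]
    simp only [e1, e2, e3, e4]
    have hu : Measurable fun x : ℝ =>
        f (Function.update (fun j => if j ∈ s then φ j (U j) else U j) i x) :=
      hf.comp (measurable_update _)
    rw [lintegral_mul_const _ hu, h i _ hu]
    refine (lintegral_mul_const _ ((hu.comp (hφ i)).mul (hw i))).symm.trans
      (lintegral_congr fun x => ?_)
    simp only [Function.comp_apply, Pi.mul_apply]
    ring

theorem lintegral_prod_pow_infinitePi (w : ι → ℝ → ℝ≥0∞) (hw : ∀ i, Measurable (w i)) (k : ℕ)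
    (s : Finset ι) :
    ∫⁻ U, (∏ i ∈ s, w i (U i)) ^ k ∂(Measure.infinitePi fun _ : ι => G) =
      ∏ i ∈ s, ∫⁻ t, w i t ^ k ∂G := by
  induction s using Finset.induction_on with
  | empty => simp
  | insert i s hi ih =>
    have hp : ∀ s : Finset ι, Measurable fun U : ι → ℝ => (∏ i ∈ s, w i (U i)) ^ k := fun s =>
      (Finset.measurable_prod _ fun j _ => (hw j).comp (measurable_pi_apply j)).pow_const k
    rw [lintegral_update_infinitePi G i (hp _), Finset.prod_insert hi, ← ih,
      ← lintegral_const_mul _ (hp s)]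
    refine lintegral_congr fun U => ?_
    have e3 : ∀ x, ∏ j ∈ s, w j (Function.update U i x j) = ∏ j ∈ s, w j (U j) := fun x =>
      Finset.prod_congr rfl fun j hj => by
        rw [Function.update_of_ne (ne_of_mem_of_not_mem hj hi)]
    simp only [Finset.prod_insert hi, e3, Function.update_self, mul_pow]
    rw [lintegral_mul_const _ ((hw i).pow_const k)]

end Product

/-! ### Lattice distance and walks -/

variable {d : ℕ}

/-- The `ℓ¹` distance on `ℤ^d`. -/
def l1dist (x y : Fin d → ℤ) : ℕ := ∑ i, (x i - y i).natAbs

lemma lattice_adj_iff {x y : Fin d → ℤ} : (lattice d).Adj x y ↔ l1dist x y = 1 := by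
  show ∑ i, |x i - y i| = 1 ↔ _
  rw [l1dist, ← Nat.cast_inj (R := ℤ)]
  push_cast
  rfl

lemma l1dist_self (x : Fin d → ℤ) : l1dist x x = 0 := by simp [l1dist]

lemma l1dist_comm (x y : Fin d → ℤ) : l1dist x y = l1dist y x :=
  Finset.sum_congr rfl fun i _ => by rw [← Int.natAbs_neg, neg_sub]

lemma l1dist_triangle (x y z : Fin d → ℤ) : l1dist x z ≤ l1dist x y + l1dist y z := by
  rw [l1dist, l1dist, l1dist, ← Finset.sum_add_distrib]
  exact Finset.sum_le_sum fun i _ => by omega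

lemma eq_of_l1dist_eq_zero {x y : Fin d → ℤ} (h : l1dist x y = 0) : x = y := by
  ext i
  have := (Finset.sum_eq_zero_iff.1 h) i (Finset.mem_univ i)
  omega

lemma l1dist_add_right (x y u : Fin d → ℤ) : l1dist (x + u) (y + u) = l1dist x y := by
  simp [l1dist]

/-- The `2d` unit steps of the lattice. -/
def step (s : Fin d × Bool) : Fin d → ℤ := Pi.single s.1 (if s.2 then 1 else -1)

lemma l1dist_add_step (x : Fin d → ℤ) (s : Fin d × Bool) : l1dist x (x + step s) = 1 := by
  rw [l1dist, Finset.sum_eq_single s.1]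
  · rcases s with ⟨i, _ | _⟩ <;> simp [step]
  · intro j _ hj
    simp [step, Pi.single_eq_of_ne hj]
  · simp

lemma exists_step_toward {x y : Fin d → ℤ} (h : x ≠ y) :
    ∃ s : Fin d × Bool, l1dist x y = l1dist (x + step s) y + 1 := by
  obtain ⟨i, hi⟩ := Function.ne_iff.1 h
  refine ⟨(i, decide (x i < y i)), ?_⟩
  rw [l1dist, l1dist, ← Finset.add_sum_erase _ _ (Finset.mem_univ i),
    ← Finset.add_sum_erase _ (fun j => ((x + step (i, decide (x i < y i))) j - y j).natAbs)
      (Finset.mem_univ i)]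
  have h1 : (x i - y i).natAbs = ((x + step (i, decide (x i < y i))) i - y i).natAbs + 1 := by
    by_cases hlt : x i < y i
    · simp [step, hlt]; omega
    · simp [step, hlt]; omega
  have h2 : ∑ j ∈ Finset.univ.erase i, (x j - y j).natAbs =
      ∑ j ∈ Finset.univ.erase i, ((x + step (i, decide (x i < y i))) j - y j).natAbs :=
    Finset.sum_congr rfl fun j hj => by
      simp [step, Pi.single_eq_of_ne (Finset.ne_of_mem_erase hj)]
  rw [h1, h2]
  ring

lemma lattice_adj_iff_exists_step {x y : Fin d → ℤ} :
    (lattice d).Adj x y ↔ ∃ s, y = x + step s := by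
  constructor
  · intro h
    obtain ⟨s, hs⟩ := exists_step_toward h.ne
    rw [lattice_adj_iff] at h
    exact ⟨s, (eq_of_l1dist_eq_zero (by omega)).symm⟩
  · rintro ⟨s, rfl⟩
    exact lattice_adj_iff.2 (l1dist_add_step x s)

lemma exists_walk_length_eq_l1dist (x y : Fin d → ℤ) :
    ∃ p : (lattice d).Walk x y, p.length = l1dist x y := by
  induction hn : l1dist x y generalizing x with
  | zero =>
    obtain rfl := eq_of_l1dist_eq_zero hn
    exact ⟨.nil, rfl⟩
  | succ n ih =>
    have hxy : x ≠ y := by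
      rintro rfl
      simp [l1dist_self] at hn
    obtain ⟨s, hs⟩ := exists_step_toward hxy
    obtain ⟨p, hp⟩ := ih (x + step s) (by omega)
    exact ⟨.cons (lattice_adj_iff_exists_step.2 ⟨s, rfl⟩) p, by simp [hp]⟩

lemma l1dist_le_length {x y : Fin d → ℤ} (p : (lattice d).Walk x y) : l1dist x y ≤ p.length := by
  induction p with
  | nil => simp [l1dist_self]
  | @cons x y z h p ih =>
    have := l1dist_triangle x y z
    rw [lattice_adj_iff] at h
    simp only [SimpleGraph.Walk.length_cons]
    omega

lemma l1dist_getVert_le {x y : Fin d → ℤ} (p : (lattice d).Walk x y) (i j : ℕ) :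
    l1dist (p.getVert i) (p.getVert (i + j)) ≤ j := by
  have h := l1dist_le_length ((p.drop i).take j)
  rw [SimpleGraph.Walk.take_length] at h
  rw [← SimpleGraph.Walk.drop_getVert]
  exact h.trans (min_le_left _ _)

noncomputable instance : (lattice d).LocallyFinite := fun x =>
  (Set.Finite.subset (Set.finite_range fun s => x + step s) fun y hy => by
    obtain ⟨s, hs⟩ := lattice_adj_iff_exists_step.1 hy
    exact ⟨s, hs.symm⟩).fintype

/-- A walk here is determined by its list of vertices. Countability makes events quantified over
walks measurable and allows null sets to be united over walks. -/
instance {x y : Fin d → ℤ} : Countable ((lattice d).Walk x y) :=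
  Function.Injective.countable (f := SimpleGraph.Walk.support)
    fun _ _ h => SimpleGraph.Walk.ext_support h

/-- The list of edges of a walk. -/
def walkEdges {x y : Fin d → ℤ} (p : (lattice d).Walk x y) : List (Edge d) :=
  p.darts.map fun a => ⟨a.edge, a.edge_mem⟩

lemma passageTime_eq (t : Edge d → ℝ) {x y : Fin d → ℤ} (p : (lattice d).Walk x y) :
    passageTime t p = ((walkEdges p).map t).sum := by
  simp [passageTime, walkEdges, Function.comp_def]

lemma walkEdges_map_val {x y : Fin d → ℤ} (p : (lattice d).Walk x y) :
    (walkEdges p).map Subtype.val = p.edges := by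
  simp [walkEdges, SimpleGraph.Walk.edges, Function.comp_def]

lemma mem_walkEdges {x y : Fin d → ℤ} (p : (lattice d).Walk x y) (e : Edge d) :
    e ∈ walkEdges p ↔ (e : Sym2 (Fin d → ℤ)) ∈ p.edges := by
  rw [← walkEdges_map_val, List.mem_map_of_injective Subtype.val_injective]

@[simp] lemma length_walkEdges {x y : Fin d → ℤ} (p : (lattice d).Walk x y) :
    (walkEdges p).length = p.length := by simp [walkEdges]

lemma walkEdges_append {x y z : Fin d → ℤ} (p : (lattice d).Walk x y) (q : (lattice d).Walk y z) :
    walkEdges (p.append q) = walkEdges p ++ walkEdges q := by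
  simp [walkEdges, SimpleGraph.Walk.darts_append]

lemma walkEdges_take {x y : Fin d → ℤ} (p : (lattice d).Walk x y) (n : ℕ) :
    walkEdges (p.take n) = (walkEdges p).take n := by
  simp [walkEdges, SimpleGraph.Walk.darts_take, List.map_take]

lemma walkEdges_drop {x y : Fin d → ℤ} (p : (lattice d).Walk x y) (n : ℕ) :
    walkEdges (p.drop n) = (walkEdges p).drop n := by
  simp [walkEdges, SimpleGraph.Walk.darts_drop, List.map_drop]

lemma passageTime_append (t : Edge d → ℝ) {x y z : Fin d → ℤ} (p : (lattice d).Walk x y)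
    (q : (lattice d).Walk y z) :
    passageTime t (p.append q) = passageTime t p + passageTime t q := by
  simp [passageTime_eq, walkEdges_append]

/-! ### Geodesics when the weights lie between two positive constants -/

section Bounds

variable {a b : ℝ} {t : Edge d → ℝ}

lemma mul_length_le_passageTime (ht : ∀ e, a ≤ t e) {x y : Fin d → ℤ}
    (p : (lattice d).Walk x y) : a * p.length ≤ passageTime t p := by
  rw [passageTime_eq, ← length_walkEdges]
  have := List.card_nsmul_le_sum ((walkEdges p).map t) a fun z hz => by
    obtain ⟨e, -, rfl⟩ := List.mem_map.1 hz
    exact ht e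
  simpa [mul_comm] using this

lemma passageTime_le_mul_length (ht : ∀ e, t e ≤ b) {x y : Fin d → ℤ}
    (p : (lattice d).Walk x y) : passageTime t p ≤ b * p.length := by
  rw [passageTime_eq, ← length_walkEdges]
  have := List.sum_le_card_nsmul ((walkEdges p).map t) b fun z hz => by
    obtain ⟨e, -, rfl⟩ := List.mem_map.1 hz
    exact ht e
  simpa [mul_comm] using this

/-- Each edge costs at least `a`, so only walks of bounded length can compete with a fixed one, and
local finiteness leaves finitely many. -/
lemma exists_isGeodesic (ha : 0 < a) (hta : ∀ e, a ≤ t e) (x y : Fin d → ℤ) :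
    ∃ p : (lattice d).Walk x y, IsGeodesic t p := by
  classical
  obtain ⟨p₀, -⟩ := exists_walk_length_eq_l1dist x y
  obtain ⟨N, hN⟩ := exists_nat_gt (passageTime t p₀ / a)
  rw [div_lt_iff₀ ha] at hN
  have hp₀ : p₀ ∈ (lattice d).finsetWalkLengthLT N x y := by
    rw [SimpleGraph.mem_finsetWalkLengthLT_iff]
    have := mul_length_le_passageTime hta p₀
    have h2 : a * p₀.length < a * N := by linarith
    exact_mod_cast lt_of_mul_lt_mul_left h2 ha.le
  obtain ⟨p, hp, hmin⟩ := Finset.exists_min_image _ (passageTime t) ⟨p₀, hp₀⟩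
  refine ⟨p, fun p' => ?_⟩
  by_cases h : p' ∈ (lattice d).finsetWalkLengthLT N x y
  · exact hmin p' h
  · rw [SimpleGraph.mem_finsetWalkLengthLT_iff, not_lt] at h
    have h1 := mul_length_le_passageTime hta p'
    have h2 : a * N ≤ a * p'.length := mul_le_mul_of_nonneg_left (by exact_mod_cast h) ha.le
    have h3 := hmin p₀ hp₀
    linarith

/-- Segments of a geodesic have length at most a constant times the distance of their ends. -/
lemma IsGeodesic.mul_le_mul_l1dist (hta : ∀ e, a ≤ t e) (htb : ∀ e, t e ≤ b)
    {x y : Fin d → ℤ} {p : (lattice d).Walk x y} (hp : IsGeodesic t p) {i j : ℕ}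
    (hij : i + j ≤ p.length) :
    a * j ≤ b * l1dist (p.getVert i) (p.getVert (i + j)) := by
  -- The competitor replaces the segment by a shortest lattice path `r`.
  obtain ⟨r, hr⟩ := exists_walk_length_eq_l1dist (p.getVert i) ((p.drop i).getVert j)
  have h1 := hp (((p.take i).append r).append ((p.drop i).drop j))
  have h2 : passageTime t p = passageTime t (p.take i) + (passageTime t ((p.drop i).take j) +
      passageTime t ((p.drop i).drop j)) := by
    rw [← passageTime_append, SimpleGraph.Walk.append_take_drop_eq, ← passageTime_append,
      SimpleGraph.Walk.append_take_drop_eq]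
  rw [passageTime_append, passageTime_append] at h1
  have h3 := mul_length_le_passageTime hta ((p.drop i).take j)
  have h4 := passageTime_le_mul_length htb r
  have h5 : ((p.drop i).take j).length = j := by
    rw [SimpleGraph.Walk.take_length, SimpleGraph.Walk.drop_length]
    omega
  rw [h5] at h3
  rw [hr] at h4
  rw [← SimpleGraph.Walk.drop_getVert]
  linarith

lemma IsGeodesic.length_mul_le (hta : ∀ e, a ≤ t e) (htb : ∀ e, t e ≤ b)
    {x y : Fin d → ℤ} {p : (lattice d).Walk x y} (hp : IsGeodesic t p) :
    a * p.length ≤ b * l1dist x y := by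
  have := hp.mul_le_mul_l1dist hta htb (i := 0) (j := p.length) (by simp)
  simpa using this

/-- A repeated vertex would bound a segment of positive length by a distance of zero. -/
lemma IsGeodesic.getVert_injOn (ha : 0 < a) (hta : ∀ e, a ≤ t e) (htb : ∀ e, t e ≤ b)
    {x y : Fin d → ℤ} {p : (lattice d).Walk x y} (hp : IsGeodesic t p) :
    Set.InjOn p.getVert {i | i ≤ p.length} := by
  have key : ∀ i j, i + j ≤ p.length → p.getVert i = p.getVert (i + j) → j = 0 := by
    intro i j hij h
    have := hp.mul_le_mul_l1dist hta htb hij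
    rw [h, l1dist_self, Nat.cast_zero, mul_zero] at this
    by_contra hj
    have : (0 : ℝ) < j := by exact_mod_cast Nat.pos_of_ne_zero hj
    nlinarith
  intro i hi j hj h
  have hi' : i ≤ p.length := hi
  have hj' : j ≤ p.length := hj
  rcases le_total i j with hij | hij
  · have := key i (j - i) (by omega) (by rw [h]; congr 1; omega)
    omega
  · have := key j (i - j) (by omega) (by rw [← h]; congr 1; omega)
    omega

lemma IsGeodesic.nodup_walkEdges (ha : 0 < a) (hta : ∀ e, a ≤ t e) (htb : ∀ e, t e ≤ b)
    {x y : Fin d → ℤ} {p : (lattice d).Walk x y} (hp : IsGeodesic t p) :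
    (walkEdges p).Nodup := by
  have hpath : p.IsPath := by
    rw [SimpleGraph.Walk.isPath_iff_injective_get_support]
    intro i j hij
    simp only at hij
    rw [List.get_eq_getElem, List.get_eq_getElem, SimpleGraph.Walk.support_getElem_eq_getVert,
      SimpleGraph.Walk.support_getElem_eq_getVert] at hij
    have hi := i.2.trans_eq p.length_support
    have hj := j.2.trans_eq p.length_support
    exact Fin.ext (hp.getVert_injOn ha hta htb (Nat.lt_succ_iff.1 hi) (Nat.lt_succ_iff.1 hj) hij)
  have := hpath.isTrail.edges_nodup
  rw [← walkEdges_map_val] at this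
  exact this.of_map _

/-- Comparison of the increments of the passage times between two pairs of nearby points. -/
lemma IsGeodesic.increment_le {t' : Edge d → ℝ} (htb : ∀ e, t e ≤ b) (htb' : ∀ e, t' e ≤ b)
    {x y x' y' : Fin d → ℤ} {p : (lattice d).Walk x y} (hp : IsGeodesic t' p)
    {p' : (lattice d).Walk x' y'} (hp' : IsGeodesic t p') :
    passageTime t' p - passageTime t p ≤
      passageTime t' p' - passageTime t p' + 2 * b * (l1dist x x' + l1dist y y') := by
  obtain ⟨r, hr⟩ := exists_walk_length_eq_l1dist x x'
  obtain ⟨s, hs⟩ := exists_walk_length_eq_l1dist y y'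
  -- Each geodesic competes, in its own environment, with the other one extended by connecting paths
  -- at both ends. Each connection is used once per environment, whence the factor `2 * b`.
  have h1 := hp ((r.append p').append s.reverse)
  have h2 := hp' ((r.reverse.append p).append s)
  simp only [passageTime_append] at h1 h2
  have h3 := passageTime_le_mul_length htb' r
  have h4 := passageTime_le_mul_length htb' s.reverse
  have h5 := passageTime_le_mul_length htb r.reverse
  have h6 := passageTime_le_mul_length htb s
  rw [SimpleGraph.Walk.length_reverse] at h4 h5
  rw [hr] at h3 h5
  rw [hs] at h4 h6
  linarith

end Bounds

/-! ### Translation invariance and measurability -/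

/-- Translation by `u` as an automorphism of the lattice. -/
def translate (u : Fin d → ℤ) : lattice d ≃g lattice d where
  toEquiv := Equiv.addRight u
  map_rel_iff' := by
    intro x y
    rw [lattice_adj_iff, lattice_adj_iff]
    exact Eq.congr_left (l1dist_add_right x y u)

/-- Translation of edges by `u`. -/
def translateEdge (u : Fin d → ℤ) : Edge d ≃ Edge d := (translate u).mapEdgeSet

lemma translateEdge_val (u : Fin d → ℤ) (e : Edge d) :
    (translateEdge u e : Sym2 (Fin d → ℤ)) = (e : Sym2 (Fin d → ℤ)).map (· + u) := rfl

lemma translateEdge_symm_val (u : Fin d → ℤ) (e : Edge d) :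
    ((translateEdge u).symm e : Sym2 (Fin d → ℤ)) = (e : Sym2 (Fin d → ℤ)).map (· + -u) := by
  obtain ⟨e, rfl⟩ := (translateEdge u).surjective e
  rw [Equiv.symm_apply_apply, translateEdge_val, Sym2.map_map]
  simp

/-- The translate of a walk. -/
def translateWalk (u : Fin d → ℤ) {x y : Fin d → ℤ} (p : (lattice d).Walk x y) :
    (lattice d).Walk (x + u) (y + u) := p.map (translate u).toHom

lemma walkEdges_translateWalk (u : Fin d → ℤ) {x y : Fin d → ℤ} (p : (lattice d).Walk x y) :
    walkEdges (translateWalk u p) = (walkEdges p).map (translateEdge u) := by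
  have : (translateWalk u p).darts = p.darts.map (translate u).toHom.mapDart :=
    SimpleGraph.Walk.darts_map _ _
  simp only [walkEdges, this, List.map_map]
  rfl

lemma passageTime_translateWalk (t : Edge d → ℝ) (u : Fin d → ℤ) {x y : Fin d → ℤ}
    (p : (lattice d).Walk x y) :
    passageTime t (translateWalk u p) = passageTime (fun e => t (translateEdge u e)) p := by
  rw [passageTime_eq, passageTime_eq, walkEdges_translateWalk, List.map_map]
  rfl

lemma exists_translateWalk_eq (u : Fin d → ℤ) {x y : Fin d → ℤ}
    (p : (lattice d).Walk (x + u) (y + u)) :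
    ∃ p' : (lattice d).Walk x y, translateWalk u p' = p := by
  have hx : (translate u).symm.toHom (x + u) = x := (translate u).symm_apply_apply x
  have hy : (translate u).symm.toHom (y + u) = y := (translate u).symm_apply_apply y
  refine ⟨(p.map (translate u).symm.toHom).copy hx hy, SimpleGraph.Walk.ext_support ?_⟩
  refine (SimpleGraph.Walk.support_map _ _).trans ?_
  refine (congrArg _ ((SimpleGraph.Walk.support_copy _ hx hy).trans
    (SimpleGraph.Walk.support_map _ _))).trans ?_
  rw [List.map_map]
  refine (List.map_congr_left (g := id) fun z _ => ?_).trans (List.map_id _)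
  exact (translate u).apply_symm_apply z

lemma translateEdge_mem_geodesicEdges (t : Edge d → ℝ) (u x y : Fin d → ℤ) (e : Edge d) :
    translateEdge u e ∈ geodesicEdges t (x + u) (y + u) ↔
      e ∈ geodesicEdges (fun e => t (translateEdge u e)) x y := by
  constructor
  · rintro ⟨p, hp, he⟩
    obtain ⟨p, rfl⟩ := exists_translateWalk_eq u p
    refine ⟨p, fun p' => ?_, ?_⟩
    · have := hp (translateWalk u p')
      rwa [passageTime_translateWalk, passageTime_translateWalk] at this
    · rw [← mem_walkEdges] at he ⊢
      rw [walkEdges_translateWalk] at he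
      exact (List.mem_map_of_injective (translateEdge u).injective).1 he
  · rintro ⟨p, hp, he⟩
    refine ⟨translateWalk u p, fun p' => ?_, ?_⟩
    · obtain ⟨p', rfl⟩ := exists_translateWalk_eq u p'
      rw [passageTime_translateWalk, passageTime_translateWalk]
      exact hp p'
    · rw [← mem_walkEdges] at he ⊢
      have : translateEdge u e ∈ walkEdges (translateWalk u p) := by
        rw [walkEdges_translateWalk]
        exact List.mem_map_of_mem he
      exact this

lemma measurable_passageTime {x y : Fin d → ℤ} (p : (lattice d).Walk x y) :
    Measurable fun t : Edge d → ℝ => passageTime t p := by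
  simp only [passageTime_eq]
  induction walkEdges p with
  | nil => simp
  | cons e l ih =>
    simp only [List.map_cons, List.sum_cons]
    exact (measurable_pi_apply e).add ih

lemma measurableSet_isGeodesic {x y : Fin d → ℤ} (p : (lattice d).Walk x y) :
    MeasurableSet {t : Edge d → ℝ | IsGeodesic t p} := by
  simp only [IsGeodesic, Set.ofPred_forall]
  exact MeasurableSet.iInter fun p' =>
    measurableSet_le (measurable_passageTime p) (measurable_passageTime p')

lemma measurableSet_mem_geodesicEdges (x y : Fin d → ℤ) (e : Edge d) :
    MeasurableSet {t : Edge d → ℝ | e ∈ geodesicEdges t x y} := by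
  have : {t : Edge d → ℝ | e ∈ geodesicEdges t x y} =
      ⋃ p : (lattice d).Walk x y, {t : Edge d → ℝ | IsGeodesic t p} ∩
        {_t : Edge d → ℝ | (e : Sym2 (Fin d → ℤ)) ∈ p.edges} := by
    ext t
    simp only [geodesicEdges, Set.mem_iUnion]
    rfl
  rw [this]
  exact MeasurableSet.iUnion fun p => (measurableSet_isGeodesic p).inter (MeasurableSet.const _)

/-- The law of an i.i.d. environment. -/
noncomputable abbrev environment (d : ℕ) (G : Measure ℝ) [IsProbabilityMeasure G] :
    Measure (Edge d → ℝ) :=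
  Measure.infinitePi fun _ => G

lemma geodesicProb_eq {G : Measure ℝ} [IsProbabilityMeasure G] {Ω : Type*} [MeasurableSpace Ω]
    {P : Measure Ω} {t : Edge d → Ω → ℝ} (h : IsIIDEnvironment P t G) (v : Fin d → ℤ)
    (e : Edge d) :
    geodesicProb P t v e = environment d G {t | e ∈ geodesicEdges t 0 v} := by
  have hl := h.indep.hasLaw_infinitePi h.hasLaw
    (aemeasurable_pi_iff.2 fun e => (h.hasLaw e).aemeasurable)
  rw [environment, ← hl.map_eq, Measure.map_apply_of_aemeasurable hl.aemeasurable
    (measurableSet_mem_geodesicEdges 0 v e)]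
  rfl

/-- Moving the end points with `e` fixed becomes moving `e` with the end points fixed. A sum over
translated geodesics thereby turns into a count of edges on one geodesic. -/
lemma environment_geodesicEdges_translate (G : Measure ℝ) [IsProbabilityMeasure G]
    (u x y : Fin d → ℤ) (e : Edge d) :
    environment d G {t | e ∈ geodesicEdges t (x + u) (y + u)} =
      environment d G {t | (translateEdge u).symm e ∈ geodesicEdges t x y} := by
  have h := Measure.map_infinitePi_infinitePi_of_inj (P := fun _ : Edge d => G)
    (translateEdge u).injective
  conv_rhs => rw [environment, ← h]
  rw [Measure.map_apply (by fun_prop) (measurableSet_mem_geodesicEdges x y _)]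
  congr 1
  ext t
  obtain ⟨e, rfl⟩ := (translateEdge u).surjective e
  have := translateEdge_mem_geodesicEdges t u x y e
  rw [Equiv.symm_apply_apply]
  exact this

lemma ae_mem_Icc {G : Measure ℝ} [IsProbabilityMeasure G] {a b : ℝ}
    (hsupp : G (Set.Icc a b)ᶜ = 0) :
    ∀ᵐ t ∂environment d G, ∀ e, t e ∈ Set.Icc a b := by
  rw [ae_all_iff]
  intro e
  have h := measurePreserving_eval_infinitePi (fun _ : Edge d => G) e
  have h2 : ∀ᵐ s ∂G, s ∈ Set.Icc a b := by rw [ae_iff]; exact hsupp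
  exact h.quasiMeasurePreserving.ae h2

/-! ### Almost sure uniqueness of the edge set -/

lemma sum_map_update_of_notMem [DecidableEq (Edge d)] {e : Edge d} {l : List (Edge d)} (h : e ∉ l)
    (t : Edge d → ℝ) (s : ℝ) : (l.map (Function.update t e s)).sum = (l.map t).sum := by
  congr 1
  exact List.map_congr_left fun e' he' => Function.update_of_ne (ne_of_mem_of_not_mem he' h) _ _

lemma sum_map_update [DecidableEq (Edge d)] (e : Edge d) (l : List (Edge d))
    (t : Edge d → ℝ) (s : ℝ) :
    (l.map (Function.update t e s)).sum = (l.map (Function.update t e 0)).sum + l.count e * s := by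
  induction l with
  | nil => simp
  | cons e' l ih =>
    rw [List.map_cons, List.sum_cons, ih, List.map_cons, List.sum_cons, List.count_cons]
    rcases eq_or_ne e' e with rfl | h
    · simp; ring
    · rw [Function.update_of_ne h, Function.update_of_ne h, if_neg (by simpa [Subtype.ext_iff] using h)]
      push_cast; ring

/-- For an atomless weight distribution, almost surely two walks with the same ends and different
sets of edges have different passage times. -/
lemma ae_passageTime_ne (G : Measure ℝ) [IsProbabilityMeasure G] [NullSingletonClass G]
    {x y : Fin d → ℤ} (p p' : (lattice d).Walk x y) {e : Edge d} (he : e ∈ walkEdges p)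
    (he' : e ∉ walkEdges p') :
    ∀ᵐ t ∂environment d G, passageTime t p ≠ passageTime t p' := by
  classical
  have hm : MeasurableSet {t : Edge d → ℝ | passageTime t p = passageTime t p'} :=
    measurableSet_eq_fun (measurable_passageTime p) (measurable_passageTime p')
  rw [ae_iff]
  simp only [ne_eq, not_not]
  rw [← lintegral_indicator_one hm, environment,
    lintegral_update_infinitePi G e (measurable_one.indicator hm)]
  refine (lintegral_congr fun t => ?_).trans lintegral_zero
  have hmu : Measurable fun s : ℝ => Set.indicator
      {t : Edge d → ℝ | passageTime t p = passageTime t p'} (1 : (Edge d → ℝ) → ℝ≥0∞)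
      (Function.update t e s) := (measurable_one.indicator hm).comp (measurable_update _)
  rw [lintegral_eq_zero_iff hmu]
  have hc : (0 : ℝ) < (walkEdges p).count e := by exact_mod_cast List.count_pos_iff.2 he
  -- With all other weights fixed, the difference of passage times is affine in the weight of `e`
  -- with nonzero slope; `s₀` is the only value that produces a tie.
  set s₀ : ℝ := (((walkEdges p').map t).sum - ((walkEdges p).map (Function.update t e 0)).sum) /
    (walkEdges p).count e with hs₀
  have hne : ∀ᵐ s ∂G, s ≠ s₀ := by
    rw [ae_iff]
    simp
  filter_upwards [hne] with s hs
  rw [Pi.zero_apply, Set.indicator_apply_eq_zero]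
  intro hmem
  have hmem' : passageTime (Function.update t e s) p = passageTime (Function.update t e s) p' := hmem
  rw [passageTime_eq, passageTime_eq, sum_map_update_of_notMem he', sum_map_update] at hmem'
  refine absurd ?_ hs
  rw [hs₀, eq_div_iff hc.ne']
  linarith

/-- Almost surely all geodesics between two given points have the same edges. -/
lemma ae_geodesicEdges_eq (G : Measure ℝ) [IsProbabilityMeasure G] [NullSingletonClass G]
    (x y : Fin d → ℤ) :
    ∀ᵐ t ∂environment d G, ∀ p : (lattice d).Walk x y, IsGeodesic t p →
      geodesicEdges t x y = {e | e ∈ walkEdges p} := by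
  have h : ∀ᵐ t ∂environment d G, ∀ p p' : (lattice d).Walk x y, ∀ e : Edge d,
      e ∈ walkEdges p → e ∉ walkEdges p' → passageTime t p ≠ passageTime t p' := by
    rw [ae_all_iff]; intro p
    rw [ae_all_iff]; intro p'
    rw [ae_all_iff]; intro e
    by_cases he : e ∈ walkEdges p
    · by_cases he' : e ∈ walkEdges p'
      · simp [he']
      · filter_upwards [ae_passageTime_ne G p p' he he'] with t ht _ _ using ht
    · simp [he]
  filter_upwards [h] with t ht p hp
  ext e
  constructor
  · rintro ⟨p', hp', he⟩
    rw [← mem_walkEdges] at he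
    by_contra hn
    exact ht p' p e he hn (le_antisymm (hp' p) (hp p'))
  · intro he
    exact ⟨p, hp, (mem_walkEdges p e).1 he⟩

/-! ### Geodesics in boxes and averaging over translates -/

lemma walkEdges_getElem {x y : Fin d → ℤ} (p : (lattice d).Walk x y) {i : ℕ}
    (hi : i < (walkEdges p).length) :
    ((walkEdges p)[i] : Sym2 (Fin d → ℤ)) = s(p.getVert i, p.getVert (i + 1)) := by
  have hi' : i < p.darts.length := by simpa using hi
  have h : ((walkEdges p)[i] : Sym2 (Fin d → ℤ)) = s(p.darts[i].fst, p.darts[i].snd) := by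
    simp only [walkEdges, List.getElem_map]
    rfl
  rw [h, SimpleGraph.Walk.fst_darts_getElem, SimpleGraph.Walk.snd_darts_getElem,
    List.getElem_dropLast, List.getElem_tail, SimpleGraph.Walk.support_getElem_eq_getVert,
    SimpleGraph.Walk.support_getElem_eq_getVert]

/-- If two translates match with end points interchanged, adding the two identities gives `2 * u = 2
* u'`. -/
lemma translateEdge_symm_injective_left (e : Edge d) :
    Function.Injective fun u : Fin d → ℤ => (translateEdge u).symm e := by
  intro u u' h
  have h2 : (e : Sym2 (Fin d → ℤ)).map (· + -u) = (e : Sym2 (Fin d → ℤ)).map (· + -u') := by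
    rw [← translateEdge_symm_val, ← translateEdge_symm_val]
    exact congrArg Subtype.val h
  obtain ⟨e, he⟩ := e
  induction e using Sym2.ind with
  | _ x y =>
    simp only [Sym2.map_mk, Sym2.eq_iff] at h2
    rcases h2 with ⟨h3, -⟩ | ⟨h3, h4⟩
    · simpa using h3
    · ext i
      have h5 := congrFun h3 i
      have h6 := congrFun h4 i
      simp only [Pi.add_apply, Pi.neg_apply] at h5 h6
      omega

/-- The box of side `2R + 1` around the origin. -/
noncomputable def cube (d R : ℕ) : Finset (Fin d → ℤ) := Finset.Icc (fun _ => -(R : ℤ)) (fun _ => (R : ℤ))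

lemma card_cube (R : ℕ) : (cube d R).card = (2 * R + 1) ^ d := by
  rw [cube, Pi.card_Icc]
  simp only [Int.card_Icc, Finset.prod_const, Finset.card_univ, Fintype.card_fin]
  congr 1
  omega

lemma l1dist_le_of_mem_cube {R : ℕ} {u : Fin d → ℤ} (hu : u ∈ cube d R) (x : Fin d → ℤ) :
    l1dist x (x + u) ≤ d * R := by
  rw [cube, Finset.mem_Icc] at hu
  have : ∀ i ∈ (Finset.univ : Finset (Fin d)), (x i - (x + u) i).natAbs ≤ R := by
    intro i _
    have h1 : -(R : ℤ) ≤ u i := hu.1 i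
    have h2 : u i ≤ R := hu.2 i
    simp only [Pi.add_apply]
    omega
  simpa [l1dist] using Finset.sum_le_card_nsmul _ _ _ this

lemma card_le_of_forall_sub_le {s : Finset ℕ} {D : ℕ} (h : ∀ i ∈ s, ∀ j ∈ s, j ≤ i + D) :
    s.card ≤ D + 1 := by
  rcases s.eq_empty_or_nonempty with rfl | hs
  · simp
  · have : s ⊆ Finset.Icc (s.min' hs) (s.min' hs + D) := fun j hj =>
      Finset.mem_Icc.2 ⟨s.min'_le j hj, h _ (s.min'_mem hs) j hj⟩
    exact (Finset.card_le_card this).trans (by rw [Nat.card_Icc]; omega)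

/-- A geodesic has few edges in a box. -/
lemma IsGeodesic.card_translates_le {a b : ℝ} {t : Edge d → ℝ} (ha : 0 < a) (hta : ∀ e, a ≤ t e)
    (htb : ∀ e, t e ≤ b) {x y : Fin d → ℤ} {p : (lattice d).Walk x y} (hp : IsGeodesic t p)
    (e : Edge d) (R : ℕ) [DecidablePred fun u => (translateEdge u).symm e ∈ walkEdges p] :
    ((cube d R).filter fun u => (translateEdge u).symm e ∈ walkEdges p).card ≤
      ⌊b / a * (2 * d * R + 2)⌋₊ + 1 := by
  classical
  set S := (cube d R).filter fun u => (translateEdge u).symm e ∈ walkEdges p with hS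
  have hex : ∀ u ∈ S, ∃ i, ∃ hi : i < (walkEdges p).length,
      (walkEdges p)[i] = (translateEdge u).symm e := fun u hu =>
    List.mem_iff_getElem.1 (Finset.mem_filter.1 hu).2
  choose! f hf hfe using hex
  have hinj : Set.InjOn f S := by
    intro u hu u' hu' h
    refine translateEdge_symm_injective_left e ?_
    simp only
    rw [← hfe u hu, ← hfe u' hu']
    simp only [h]
  rw [← Finset.card_image_of_injOn hinj]
  refine card_le_of_forall_sub_le ?_
  -- All translates lie near one end `c` of `e`. Two of their positions on `p` are thus at distance
  -- at most `2 * d * R + 2`, and the geodesic segment between them is at most `b / a` times as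
  -- long.
  obtain ⟨c, hc⟩ : ∃ c, c ∈ (e : Sym2 (Fin d → ℤ)) := ⟨_, Sym2.out_fst_mem _⟩
  have hdist : ∀ u ∈ S, l1dist (p.getVert (f u)) c ≤ d * R + 1 := by
    intro u hu
    have h1 := congrArg Subtype.val (hfe u hu)
    rw [walkEdges_getElem, translateEdge_symm_val] at h1
    have h2 : c + -u ∈ s(p.getVert (f u), p.getVert (f u + 1)) := by
      rw [h1]
      exact Sym2.mem_map.2 ⟨c, hc, rfl⟩
    have h3 : l1dist (p.getVert (f u)) (c + -u) ≤ 1 := by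
      rcases Sym2.mem_iff.1 h2 with h | h
      · rw [h, l1dist_self]; omega
      · rw [h]
        exact l1dist_getVert_le p _ _
    have h4 : l1dist (c + -u) c ≤ d * R := by
      have := l1dist_le_of_mem_cube (Finset.mem_filter.1 hu).1 (c + -u)
      simpa using this
    have := l1dist_triangle (p.getVert (f u)) (c + -u) c
    omega
  intro i hi j hj
  obtain ⟨u, hu, rfl⟩ := Finset.mem_image.1 hi
  obtain ⟨u', hu', rfl⟩ := Finset.mem_image.1 hj
  rcases le_total (f u') (f u) with h | h
  · omega
  have h1 : f u + (f u' - f u) ≤ p.length := by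
    have := hf u' hu'
    rw [length_walkEdges] at this
    omega
  have h2 := hp.mul_le_mul_l1dist hta htb h1
  have h3 : l1dist (p.getVert (f u)) (p.getVert (f u + (f u' - f u))) ≤ 2 * d * R + 2 := by
    rw [Nat.add_sub_cancel' h]
    have h4 := l1dist_triangle (p.getVert (f u)) c (p.getVert (f u'))
    have h5 := hdist u hu
    have h6 := hdist u' hu'
    rw [l1dist_comm] at h6
    have : 2 * d * R = d * R + d * R := by ring
    omega
  have hb : 0 ≤ b := (ha.le.trans (hta e)).trans (htb e)
  have h4 : ((f u' - f u : ℕ) : ℝ) ≤ b / a * (2 * d * R + 2) := by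
    rw [div_mul_eq_mul_div, le_div_iff₀ ha, mul_comm]
    refine h2.trans (mul_le_mul_of_nonneg_left ?_ hb)
    exact_mod_cast h3
  have := Nat.le_floor h4
  omega

open Classical in
/-- The total `q`-weight of the edges of the geodesics between two points. -/
noncomputable def geodesicWeight (q : Edge d → ℝ≥0) (x y : Fin d → ℤ) (t : Edge d → ℝ) : ℝ≥0∞ :=
  ∑' e : Edge d, (q e : ℝ≥0∞) * Set.indicator {t : Edge d → ℝ | e ∈ geodesicEdges t x y} 1 t

lemma measurable_geodesicWeight (q : Edge d → ℝ≥0) (x y : Fin d → ℤ) :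
    Measurable (geodesicWeight q x y) :=
  Measurable.tsum fun e =>
    (measurable_one.indicator (measurableSet_mem_geodesicEdges x y e)).const_mul _

lemma lintegral_geodesicWeight (G : Measure ℝ) [IsProbabilityMeasure G] (q : Edge d → ℝ≥0)
    (x y : Fin d → ℤ) :
    ∫⁻ t, geodesicWeight q x y t ∂environment d G =
      ∑' e, (q e : ℝ≥0∞) * environment d G {t | e ∈ geodesicEdges t x y} := by
  simp only [geodesicWeight]
  have hm : ∀ e : Edge d, Measurable
      (Set.indicator {t : Edge d → ℝ | e ∈ geodesicEdges t x y} (1 : (Edge d → ℝ) → ℝ≥0∞)) :=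
    fun e => measurable_one.indicator (measurableSet_mem_geodesicEdges x y e)
  rw [lintegral_tsum fun e => ((hm e).const_mul _).aemeasurable]
  refine tsum_congr fun e => ?_
  rw [lintegral_const_mul _ (hm e), lintegral_indicator_one (measurableSet_mem_geodesicEdges x y e)]

/-- Averaging over the translates of the end points in a box. -/
lemma sum_lintegral_geodesicWeight_le {G : Measure ℝ} [IsProbabilityMeasure G]
    [NullSingletonClass G] {a b : ℝ} (ha : 0 < a) (hsupp : G (Set.Icc a b)ᶜ = 0)
    (q : Edge d → ℝ≥0) (x y : Fin d → ℤ) (R : ℕ) :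
    ∑ u ∈ cube d R, ∫⁻ t, geodesicWeight q (x + u) (y + u) t ∂environment d G ≤
      ((⌊b / a * (2 * d * R + 2)⌋₊ + 1 : ℕ) : ℝ≥0∞) * ∑' e, (q e : ℝ≥0∞) := by
  classical
  simp only [lintegral_geodesicWeight, environment_geodesicEdges_translate]
  -- After exchanging the sums, the inner sum for fixed `e` counts its translates lying on the
  -- geodesic from `x` to `y`.
  rw [← Summable.tsum_finsetSum fun _ _ => ENNReal.summable, ← ENNReal.tsum_mul_left]
  refine ENNReal.tsum_le_tsum fun e => ?_
  rw [← Finset.mul_sum, mul_comm]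
  refine mul_le_mul_left ?_ _
  have hm : ∀ u, MeasurableSet {t : Edge d → ℝ | (translateEdge u).symm e ∈ geodesicEdges t x y} :=
    fun u => measurableSet_mem_geodesicEdges x y _
  simp only [← lintegral_indicator_one (hm _)]
  rw [← lintegral_finsetSum _ fun u _ => measurable_one.indicator (hm u)]
  have hbound : ∀ᵐ t ∂environment d G, ∑ u ∈ cube d R,
      Set.indicator {t : Edge d → ℝ | (translateEdge u).symm e ∈ geodesicEdges t x y} 1 t ≤
      ((⌊b / a * (2 * d * R + 2)⌋₊ + 1 : ℕ) : ℝ≥0∞) := by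
    filter_upwards [ae_mem_Icc hsupp, ae_geodesicEdges_eq G x y] with t ht hu
    obtain ⟨p, hp⟩ := exists_isGeodesic ha (fun e => (ht e).1) x y
    have hc := hp.card_translates_le ha (fun e => (ht e).1) (fun e => (ht e).2) e R
    refine le_trans (le_of_eq ?_) (Nat.cast_le.2 hc)
    rw [Finset.card_filter, Nat.cast_sum]
    refine Finset.sum_congr rfl fun u _ => ?_
    rw [Set.indicator_apply]
    have : t ∈ {t : Edge d → ℝ | (translateEdge u).symm e ∈ geodesicEdges t x y} ↔
        (translateEdge u).symm e ∈ walkEdges p := by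
      show _ ∈ geodesicEdges t x y ↔ _
      rw [hu p hp]
      rfl
    simp only [this]
    split_ifs <;> simp
  refine (lintegral_mono_ae hbound).trans ?_
  rw [lintegral_const, measure_univ, mul_one]

/-- This direction needs no uniqueness, so it applies to all translated end points in the same
environment; the equality in `geodesicWeight_eq` is reserved for the geodesic of the shifted
environment. -/
lemma sum_le_geodesicWeight (q : Edge d → ℝ≥0) {x y : Fin d → ℤ} {t : Edge d → ℝ}
    {p : (lattice d).Walk x y} (hp : IsGeodesic t p) (hnd : (walkEdges p).Nodup) :
    ((((walkEdges p).map q).sum : ℝ≥0) : ℝ≥0∞) ≤ geodesicWeight q x y t := by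
  classical
  rw [← List.sum_toFinset _ hnd, ENNReal.ofNNReal_finsetSum]
  refine le_trans (Finset.sum_le_sum fun e he => ?_) (ENNReal.sum_le_tsum _)
  have : t ∈ {t : Edge d → ℝ | e ∈ geodesicEdges t x y} :=
    ⟨p, hp, (mem_walkEdges p e).1 (List.mem_toFinset.1 he)⟩
  rw [Set.indicator_of_mem this]
  simp

lemma geodesicWeight_eq (q : Edge d → ℝ≥0) {x y : Fin d → ℤ} {t : Edge d → ℝ}
    {p : (lattice d).Walk x y} (hp : geodesicEdges t x y = {e | e ∈ walkEdges p})
    (hnd : (walkEdges p).Nodup) :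
    geodesicWeight q x y t = ((((walkEdges p).map q).sum : ℝ≥0) : ℝ≥0∞) := by
  classical
  rw [← List.sum_toFinset _ hnd, ENNReal.ofNNReal_finsetSum, geodesicWeight,
    tsum_eq_sum (s := (walkEdges p).toFinset)]
  · refine Finset.sum_congr rfl fun e he => ?_
    have : t ∈ {t : Edge d → ℝ | e ∈ geodesicEdges t x y} := by
      show e ∈ geodesicEdges t x y
      rw [hp]
      exact List.mem_toFinset.1 he
    rw [Set.indicator_of_mem this]
    simp
  · intro e he
    have : t ∉ {t : Edge d → ℝ | e ∈ geodesicEdges t x y} := by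
      show ¬ e ∈ geodesicEdges t x y
      rw [hp]
      exact fun h => he (List.mem_toFinset.2 h)
    rw [Set.indicator_of_notMem this, mul_zero]

/-! ### Exceptional weights along walks -/

lemma norm_toEuclid_sub_le (x y : Fin d → ℤ) : ‖toEuclid x - toEuclid y‖ ≤ l1dist x y := by
  have h : toEuclid x - toEuclid y =
      ∑ i, EuclideanSpace.single i ((x i - y i : ℤ) : ℝ) := by
    ext j
    simp [toEuclid, Finset.sum_apply]
  rw [h, l1dist, Nat.cast_sum]
  refine (norm_sum_le _ _).trans (Finset.sum_le_sum fun i _ => ?_)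
  rw [PiLp.norm_single, Real.norm_eq_abs, Nat.cast_natAbs, Int.cast_abs]

/-- Both end points move by at most `k` and the center is their average. This converts
log-smoothness into slow variation along a walk. -/
lemma edgeDist_getElem_le {x y : Fin d → ℤ} (p : (lattice d).Walk x y) {i k : ℕ}
    (hi : i < (walkEdges p).length) (hk : i + k < (walkEdges p).length) :
    edgeDist (walkEdges p)[i] (walkEdges p)[i + k] ≤ k := by
  rw [edgeDist, walkEdges_getElem, walkEdges_getElem, dist_eq_norm]
  show ‖(2 : ℝ)⁻¹ • (toEuclid (p.getVert i) + toEuclid (p.getVert (i + 1))) -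
    (2 : ℝ)⁻¹ • (toEuclid (p.getVert (i + k)) + toEuclid (p.getVert (i + k + 1)))‖ ≤ k
  rw [← smul_sub, add_sub_add_comm, norm_smul]
  have h1 := (norm_toEuclid_sub_le (p.getVert i) (p.getVert (i + k))).trans
    (Nat.cast_le.2 (l1dist_getVert_le p i k))
  have h2 := (norm_toEuclid_sub_le (p.getVert (i + 1)) (p.getVert (i + 1 + k))).trans
    (Nat.cast_le.2 (l1dist_getVert_le p (i + 1) k))
  rw [add_right_comm] at h2
  have h3 := norm_add_le (toEuclid (p.getVert i) - toEuclid (p.getVert (i + k)))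
    (toEuclid (p.getVert (i + 1)) - toEuclid (p.getVert (i + k + 1)))
  rw [Real.norm_eq_abs, abs_of_pos (by norm_num)]
  linarith

/-- The edge from `x` in a given direction. -/
def stepEdge (x : Fin d → ℤ) (s : Fin d × Bool) : Edge d :=
  ⟨s(x, x + step s), (lattice d).mem_edgeSet.2 (lattice_adj_iff_exists_step.2 ⟨s, rfl⟩)⟩

open Classical in
/-- The edge sets of the walks of length `L` started at `x`. -/
noncomputable def walkEdgeSets : ℕ → (Fin d → ℤ) → Finset (Finset (Edge d))
  | 0, _ => {∅}
  | L + 1, x => Finset.univ.biUnion fun s =>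
      (walkEdgeSets L (x + step s)).image (insert (stepEdge x s))

lemma card_walkEdgeSets_le (L : ℕ) (x : Fin d → ℤ) : (walkEdgeSets L x).card ≤ (2 * d) ^ L := by
  classical
  induction L generalizing x with
  | zero => simp [walkEdgeSets]
  | succ L ih =>
    rw [walkEdgeSets]
    refine Finset.card_biUnion_le.trans ?_
    refine (Finset.sum_le_card_nsmul _ _ ((2 * d) ^ L) fun s _ =>
      Finset.card_image_le.trans (ih _)).trans ?_
    simp only [Finset.card_univ, Fintype.card_prod, Fintype.card_fin, Fintype.card_bool,
      smul_eq_mul]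
    rw [pow_succ, mul_comm d 2, mul_comm]

open Classical in
lemma toFinset_walkEdges_mem {x y : Fin d → ℤ} (p : (lattice d).Walk x y) :
    (walkEdges p).toFinset ∈ walkEdgeSets p.length x := by
  induction p with
  | nil => simp [walkEdges, walkEdgeSets]
  | @cons x z y h p ih =>
    obtain ⟨s, rfl⟩ := lattice_adj_iff_exists_step.1 h
    rw [SimpleGraph.Walk.length_cons, walkEdgeSets, Finset.mem_biUnion]
    refine ⟨s, Finset.mem_univ _, Finset.mem_image.2 ⟨_, ih, ?_⟩⟩
    have : walkEdges (SimpleGraph.Walk.cons h p) = stepEdge x s :: walkEdges p := rfl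
    rw [this, List.toFinset_cons]

open Classical in
/-- The probability that at least half of the weights on a given set of `L` edges are exceptional. -/
lemma measure_half_exceptional_le (G : Measure ℝ) [IsProbabilityMeasure G] {B : Set ℝ}
    (hB : MeasurableSet B) {η : ℝ≥0∞} (hη : η ≤ 1) (hGB : G B ≤ η ^ 2) (W : Finset (Edge d)) :
    environment d G {t | W.card ≤ 2 * (W.filter fun e => t e ∈ B).card} ≤
      (2 * η) ^ W.card := by
  -- Union bound over the at most `2 ^ W.card` possible sets of exceptional edges. Each has at least
  -- half the edges, so the hypothesis with `η ^ 2` yields `η ^ W.card`.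
  have hsub : {t : Edge d → ℝ | W.card ≤ 2 * (W.filter fun e => t e ∈ B).card} ⊆
      ⋃ S ∈ W.powerset.filter (fun S => W.card ≤ 2 * S.card), (S : Set (Edge d)).pi fun _ => B := by
    intro t ht
    simp only [Set.mem_iUnion, Finset.mem_filter, Finset.mem_powerset]
    exact ⟨W.filter fun e => t e ∈ B, ⟨Finset.filter_subset _ _, ht⟩,
      fun e he => (Finset.mem_filter.1 he).2⟩
  refine (measure_mono hsub).trans ((measure_biUnion_finset_le _ _).trans ?_)
  have hS : ∀ S ∈ W.powerset.filter (fun S => W.card ≤ 2 * S.card),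
      environment d G ((S : Set (Edge d)).pi fun _ => B) ≤ η ^ W.card := by
    intro S hS
    rw [environment, Measure.infinitePi_pi _ fun _ _ => hB, Finset.prod_const]
    calc G B ^ S.card ≤ (η ^ 2) ^ S.card := pow_le_pow_left' hGB _
      _ = η ^ (2 * S.card) := (pow_mul _ _ _).symm
      _ ≤ η ^ W.card := pow_le_pow_right_of_le_one' hη (Finset.mem_filter.1 hS).2
  refine (Finset.sum_le_card_nsmul _ _ _ hS).trans ?_
  rw [nsmul_eq_mul, mul_pow]
  refine mul_le_mul_left ?_ _
  have := Finset.card_filter_le W.powerset (fun S => W.card ≤ 2 * S.card)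
  rw [Finset.card_powerset] at this
  exact_mod_cast this

open Classical in
/-- The event that some trail of length `L` started in a box has at least half of its weights
exceptional. -/
def exceptionalEvent (B : Set ℝ) (L R : ℕ) : Set (Edge d → ℝ) :=
  ⋃ x ∈ cube d R, ⋃ W ∈ (walkEdgeSets L x).filter (fun W => W.card = L),
    {t | W.card ≤ 2 * (W.filter fun e => t e ∈ B).card}

/-- There are `(2 * R + 1) ^ d` starting points and at most `(2 * d) ^ L` edge sets from each, every
one costing `(2 * η) ^ L`. -/
lemma measure_exceptionalEvent_le (G : Measure ℝ) [IsProbabilityMeasure G] {B : Set ℝ}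
    (hB : MeasurableSet B) {η : ℝ≥0∞} (hη : η ≤ 1) (hGB : G B ≤ η ^ 2) (L R : ℕ) :
    environment d G (exceptionalEvent B L R) ≤ ((2 * R + 1) ^ d : ℕ) * (4 * d * η) ^ L := by
  classical
  have h1 : ∀ x ∈ cube d R, environment d G
      (⋃ W ∈ (walkEdgeSets L x).filter (fun W => W.card = L),
        {t | W.card ≤ 2 * (W.filter fun e => t e ∈ B).card}) ≤ (4 * d * η) ^ L := by
    intro x _
    refine (measure_biUnion_finset_le _ _).trans ?_
    have h2 : ∀ W ∈ (walkEdgeSets L x).filter (fun W => W.card = L),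
        environment d G {t | W.card ≤ 2 * (W.filter fun e => t e ∈ B).card} ≤ (2 * η) ^ L := by
      intro W hW
      have := measure_half_exceptional_le G hB hη hGB W
      rwa [(Finset.mem_filter.1 hW).2] at this ⊢
    refine (Finset.sum_le_card_nsmul _ _ _ h2).trans ?_
    have h3 := (Finset.card_filter_le (walkEdgeSets L x) (fun W => W.card = L)).trans
      (card_walkEdgeSets_le L x)
    rw [nsmul_eq_mul]
    calc _ ≤ (((2 * d) ^ L : ℕ) : ℝ≥0∞) * (2 * η) ^ L := mul_le_mul_left (by exact_mod_cast h3) _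
      _ = (4 * d * η) ^ L := by
        push_cast
        rw [← mul_pow]
        congr 1
        ring
  refine (measure_biUnion_finset_le _ _).trans ((Finset.sum_le_card_nsmul _ _ _ h1).trans ?_)
  rw [nsmul_eq_mul, card_cube]

open Classical in
lemma measurableSet_exceptionalEvent {B : Set ℝ} (hB : MeasurableSet B) (L R : ℕ) :
    MeasurableSet (exceptionalEvent B L R : Set (Edge d → ℝ)) := by
  refine Finset.measurableSet_biUnion _ fun x _ => Finset.measurableSet_biUnion _ fun W _ => ?_
  refine measurableSet_le measurable_const ?_
  have : (fun t : Edge d → ℝ => 2 * (W.filter fun e => t e ∈ B).card) =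
      fun t => 2 * ∑ e ∈ W, Set.indicator {t : Edge d → ℝ | t e ∈ B} (1 : (Edge d → ℝ) → ℕ) t := by
    ext t
    rw [Finset.card_filter]
    simp [Set.indicator_apply]
  rw [this]
  refine Measurable.const_mul (Finset.measurable_sum _ fun e _ => measurable_one.indicator ?_) 2
  exact measurable_pi_apply e hB

open Classical in
lemma two_mul_countP_lt {B : Set ℝ} {L R : ℕ} {t : Edge d → ℝ} (ht : t ∉ exceptionalEvent B L R)
    {x y : Fin d → ℤ} (p : (lattice d).Walk x y) (hx : x ∈ cube d R) (hL : p.length = L)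
    (hnd : (walkEdges p).Nodup) :
    2 * (walkEdges p).countP (fun e => decide (t e ∈ B)) < L := by
  by_contra! h
  refine ht ?_
  have hcard : (walkEdges p).toFinset.card = L := by
    rw [List.toFinset_card_of_nodup hnd, length_walkEdges, hL]
  simp only [exceptionalEvent, Set.mem_iUnion]
  refine ⟨x, hx, (walkEdges p).toFinset,
    Finset.mem_filter.2 ⟨hL ▸ toFinset_walkEdges_mem p, hcard⟩, ?_⟩
  show (walkEdges p).toFinset.card ≤ _
  rw [hcard]
  refine h.trans (le_of_eq ?_)
  rw [List.countP_eq_length_filter, ← List.toFinset_card_of_nodup (hnd.filter _),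
    List.toFinset_filter]
  simp

/-! ### Good edges carry a fixed fraction of a slowly varying weight -/

section Windows

variable {β : Type*} {q : β → ℝ} {bad : β → Bool}

lemma mul_sub_countP_le_sum {m : ℝ} {l : List β} (h : ∀ e ∈ l, m ≤ q e) :
    m * ((l.length : ℝ) - l.countP bad) ≤ (l.map fun e => if bad e then 0 else q e).sum := by
  induction l with
  | nil => simp
  | cons e l ih =>
    have ih' := ih fun e he => h e (List.mem_cons_of_mem _ he)
    have h1 := h e List.mem_cons_self
    rw [List.map_cons, List.sum_cons, List.length_cons, List.countP_cons]
    split_ifs with hb <;> push_cast <;> linarith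

/-- The total is at most `2 * L * (10 * q₀)`, while at least `L / 2` good entries of size at least
`q₀ / 10` contribute `L * q₀ / 20`; the quotient is 400. -/
lemma sum_window_le {L : ℕ} {l : List β} {q₀ : ℝ} (hq₀ : 0 ≤ q₀) (hLl : L ≤ l.length)
    (hl : l.length ≤ 2 * L) (h1 : ∀ e ∈ l, q e ≤ 10 * q₀) (h2 : ∀ e ∈ l, q₀ ≤ 10 * q e)
    (hbad : 2 * (l.take L).countP bad ≤ L) :
    (l.map q).sum ≤ 400 * (l.map fun e => if bad e then 0 else q e).sum := by
  have e1 : (l.map q).sum ≤ 2 * L * (10 * q₀) := by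
    have := List.sum_le_card_nsmul (l.map q) (10 * q₀) fun z hz => by
      obtain ⟨e, he, rfl⟩ := List.mem_map.1 hz
      exact h1 e he
    rw [nsmul_eq_mul, List.length_map] at this
    refine this.trans (mul_le_mul_of_nonneg_right ?_ (by positivity))
    exact_mod_cast hl
  have e2 : q₀ / 10 * (((l.take L).length : ℝ) - (l.take L).countP bad) ≤
      ((l.take L).map fun e => if bad e then 0 else q e).sum :=
    mul_sub_countP_le_sum fun e he => by linarith [h2 e (List.mem_of_mem_take he)]
  have e3 : ((l.take L).map fun e => if bad e then 0 else q e).sum ≤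
      (l.map fun e => if bad e then 0 else q e).sum := by
    conv_rhs => rw [← List.take_append_drop L l, List.map_append, List.sum_append]
    refine le_add_of_nonneg_right (List.sum_nonneg fun z hz => ?_)
    obtain ⟨e, he, rfl⟩ := List.mem_map.1 hz
    split_ifs
    · exact le_rfl
    · linarith [h2 e (List.mem_of_mem_drop he)]
  have e4 : (2 : ℝ) * (l.take L).countP bad ≤ L := by exact_mod_cast hbad
  rw [List.length_take, min_eq_left hLl] at e2
  nlinarith

/-- If `q` varies slowly along a list and among any `L` consecutive entries at most half are bad,
then the good entries carry a positive fraction of the total. -/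
lemma sum_le_sum_good {L : ℕ} (hL : 0 < L) (l : List β) (hq : ∀ e, 0 ≤ q e) (hLl : L ≤ l.length)
    (hslow : ∀ i k, (hk : i + k < l.length) → k ≤ 2 * L →
      q l[i] ≤ 10 * q l[i + k] ∧ q l[i + k] ≤ 10 * q l[i])
    (hbad : ∀ i, i + L ≤ l.length → 2 * ((l.drop i).take L).countP bad ≤ L) :
    (l.map q).sum ≤ 400 * (l.map fun e => if bad e then 0 else q e).sum := by
  induction hn : l.length using Nat.strong_induction_on generalizing l with
  | _ n ih =>
    subst hn
    have hpos : 0 < l.length := hL.trans_le hLl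
    have hnear : ∀ k, (hk : k < l.length) → k ≤ 2 * L →
        q l[0] ≤ 10 * q l[k] ∧ q l[k] ≤ 10 * q l[0] := by
      intro k hk hkL
      have := hslow 0 k (by omega) hkL
      simpa using this
    have hbad0 := hbad 0 (by omega)
    rw [List.drop_zero] at hbad0
    -- Windows of length `L` are peeled off until fewer than `2 * L` entries remain, so no final
    -- window is shorter than `L`.
    by_cases h : l.length < 2 * L
    · refine sum_window_le (hq l[0]) hLl h.le (fun e he => ?_) (fun e he => ?_) hbad0
      · obtain ⟨k, hk, rfl⟩ := List.mem_iff_getElem.1 he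
        exact (hnear k hk (by omega)).2
      · obtain ⟨k, hk, rfl⟩ := List.mem_iff_getElem.1 he
        exact (hnear k hk (by omega)).1
    · have hlen : (l.take L).length = L := by rw [List.length_take, min_eq_left hLl]
      have e1 : ((l.take L).map q).sum ≤
          400 * ((l.take L).map fun e => if bad e then 0 else q e).sum := by
        refine sum_window_le (L := L) (hq l[0]) hlen.ge (by omega) (fun e he => ?_)
          (fun e he => ?_) ?_
        · obtain ⟨k, hk, rfl⟩ := List.mem_iff_getElem.1 he
          rw [List.getElem_take]
          exact (hnear k (by omega) (by omega)).2
        · obtain ⟨k, hk, rfl⟩ := List.mem_iff_getElem.1 he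
          rw [List.getElem_take]
          exact (hnear k (by omega) (by omega)).1
        · rwa [List.take_take, min_self]
      have e2 : ((l.drop L).map q).sum ≤
          400 * ((l.drop L).map fun e => if bad e then 0 else q e).sum := by
        refine ih (l.drop L).length (by rw [List.length_drop]; omega) (l.drop L)
          (by rw [List.length_drop]; omega) ?_ ?_ rfl
        · intro i k hk hkL
          rw [List.length_drop] at hk
          simp only [List.getElem_drop]
          have := hslow (L + i) k (by omega) hkL
          simpa only [add_assoc] using this
        · intro i hi
          rw [List.length_drop] at hi
          rw [List.drop_drop]
          exact hbad (L + i) (by omega)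
      rw [← List.take_append_drop L l, List.map_append, List.map_append, List.sum_append,
        List.sum_append]
      linarith

end Windows

open Classical in
/-- Outside of the exceptional event, the non-exceptional edges of a geodesic carry a positive
fraction of its total weight. -/
lemma sum_walkEdges_le_sum_good {B : Set ℝ} {L R : ℕ} (hL : 0 < L) {t : Edge d → ℝ}
    (ht : t ∉ exceptionalEvent B L R) {x y : Fin d → ℤ} (p : (lattice d).Walk x y)
    (hnd : (walkEdges p).Nodup) (hLp : L ≤ p.length)
    (hR : ∀ i ≤ p.length, p.getVert i ∈ cube d R)
    {n : ℝ} (hLn : (L : ℝ) ≤ Real.log n) {q : Edge d → ℝ≥0} (hq : IsLogSmooth n q) :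
    ((walkEdges p).map fun e => (q e : ℝ)).sum ≤
      400 * ((walkEdges p).map fun e => if t e ∈ B then 0 else (q e : ℝ)).sum := by
  have key := sum_le_sum_good (q := fun e => (q e : ℝ)) (bad := fun e => decide (t e ∈ B)) hL
    (walkEdges p) (fun e => NNReal.coe_nonneg _) (by simpa using hLp) ?_ ?_
  · simpa using key
  · intro i k hk hkL
    have h1 := edgeDist_getElem_le p (by omega) hk
    have h2 : (k : ℝ) ≤ 2 * L := by exact_mod_cast hkL
    have h3 := hq (walkEdges p)[i] (walkEdges p)[i + k] (by linarith)
    have h4 : (1 / 10 : ℝ) * (q (walkEdges p)[i + k] : ℝ) ≤ q (walkEdges p)[i] := by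
      have := NNReal.coe_le_coe.2 h3.1
      push_cast at this
      exact this
    have h5 : (q (walkEdges p)[i] : ℝ) ≤ 10 * q (walkEdges p)[i + k] := by
      have := NNReal.coe_le_coe.2 h3.2
      push_cast at this
      exact this
    exact ⟨h5, by linarith⟩
  · intro i hi
    rw [length_walkEdges] at hi
    have h1 := two_mul_countP_lt ht ((p.drop i).take L) (hR i (by omega)) (by
      rw [SimpleGraph.Walk.take_length, SimpleGraph.Walk.drop_length]; omega) (by
      rw [walkEdges_take, walkEdges_drop]
      exact (hnd.sublist (List.drop_sublist _ _)).sublist (List.take_sublist _ _))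
    rw [walkEdges_take, walkEdges_drop] at h1
    exact h1.le

/-! ### Comparing the two environments and the weak type bound -/

lemma mul_sum_map_le_sub {β : Type*} {f g h : β → ℝ} {l : List β} (c : ℝ)
    (hl : ∀ e ∈ l, c * f e ≤ h e - g e) :
    c * (l.map f).sum ≤ (l.map h).sum - (l.map g).sum := by
  induction l with
  | nil => simp
  | cons e l ih =>
    have h1 := ih fun e he => hl e (List.mem_cons_of_mem _ he)
    have h2 := hl e List.mem_cons_self
    simp only [List.map_cons, List.sum_cons]
    linarith

lemma sub_sum_map_le_mul {β : Type*} {f g h : β → ℝ} {l : List β} (c : ℝ)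
    (hl : ∀ e ∈ l, h e - g e ≤ c * f e) :
    (l.map h).sum - (l.map g).sum ≤ c * (l.map f).sum := by
  induction l with
  | nil => simp
  | cons e l ih =>
    have h1 := ih fun e he => hl e (List.mem_cons_of_mem _ he)
    have h2 := hl e List.mem_cons_self
    simp only [List.map_cons, List.sum_cons]
    linarith

open Classical in
/-- The weight of a geodesic in the shifted environment is controlled by the weight of the
geodesics between nearby points in the original environment. -/
lemma weight_le_weight_translate {a b A κ δ : ℝ} (hκ : 0 ≤ κ) (hδ : 0 ≤ δ) (hb : 0 ≤ b)
    {B : Set ℝ} {t t' : Edge d → ℝ} (ht : ∀ e, t e ∈ Set.Icc a b) (ht' : ∀ e, t' e ∈ Set.Icc a b)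
    {q : Edge d → ℝ≥0} (hshift : ∀ e, t e ≤ t' e ∧ t' e ≤ t e + A * (δ * q e))
    {v : Fin d → ℤ} {p : (lattice d).Walk 0 v} (hp : IsGeodesic t' p)
    (hgood : ∀ e ∈ walkEdges p, t e ∉ B → t e + κ * (δ * q e) ≤ t' e)
    (hsum : ((walkEdges p).map fun e => (q e : ℝ)).sum ≤
      400 * ((walkEdges p).map fun e => if t e ∈ B then 0 else (q e : ℝ)).sum)
    {R : ℕ} {u : Fin d → ℤ} (hu : u ∈ cube d R) {p₀ : (lattice d).Walk (0 + u) (v + u)}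
    (hp₀ : IsGeodesic t p₀) :
    κ * δ * ((walkEdges p).map fun e => (q e : ℝ)).sum ≤
      400 * (A * δ * ((walkEdges p₀).map fun e => (q e : ℝ)).sum + 4 * b * d * R) := by
  have h1 := IsGeodesic.increment_le (fun e => (ht e).2) (fun e => (ht' e).2) hp hp₀
  have h2 : κ * δ * ((walkEdges p).map fun e => if t e ∈ B then 0 else (q e : ℝ)).sum ≤
      passageTime t' p - passageTime t p := by
    rw [passageTime_eq, passageTime_eq]
    refine mul_sum_map_le_sub _ fun e he => ?_
    split_ifs with hB
    · linarith [(hshift e).1]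
    · linarith [hgood e he hB]
  have h3 : passageTime t' p₀ - passageTime t p₀ ≤
      A * δ * ((walkEdges p₀).map fun e => (q e : ℝ)).sum := by
    rw [passageTime_eq, passageTime_eq]
    exact sub_sum_map_le_mul _ fun e _ => by linarith [(hshift e).2]
  have h4 : ((l1dist 0 (0 + u) : ℝ) + l1dist v (v + u)) ≤ 2 * (d * R) := by
    have h5 : (l1dist 0 (0 + u) : ℝ) ≤ d * R := by
      exact_mod_cast l1dist_le_of_mem_cube hu 0
    have h6 : (l1dist v (v + u) : ℝ) ≤ d * R := by
      exact_mod_cast l1dist_le_of_mem_cube hu v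
    linarith
  have h7 := mul_le_mul_of_nonneg_left h4 (show 0 ≤ 2 * b by linarith)
  have h8 := mul_le_mul_of_nonneg_left hsum (mul_nonneg hκ hδ)
  linarith

/-- A weak type bound of order `d` for the weight of the geodesic in a shifted environment. -/
lemma weak_type_bound {G : Measure ℝ} [IsProbabilityMeasure G] [NullSingletonClass G]
    {a b A κ δ : ℝ} (hd : 1 ≤ d) (ha : 0 < a) (hb : 0 < b) (hsupp : G (Set.Icc a b)ᶜ = 0)
    (hA : 0 < A) (hκ : 0 < κ) (hδ : 0 < δ) (q : Edge d → ℝ≥0) (v : Fin d → ℤ)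
    (E : Set (Edge d → ℝ)) {s : ℝ} (hs : 0 < s)
    (hpath : ∀ᵐ t ∂environment d G, t ∈ E → ∀ R : ℕ, ∀ u ∈ cube d R,
      ENNReal.ofReal ((κ * δ * s - 1600 * b * d * R) / (400 * A * δ)) ≤
        geodesicWeight q (0 + u) (v + u) t) :
    ENNReal.ofReal ((κ / (3200 * b * d) * δ * s) ^ (d - 1) * (κ / (800 * A) * s)) *
        environment d G (E) ≤
      ENNReal.ofReal (b / a * (d + 2) + 1) * ∑' e, (q e : ℝ≥0∞) := by
  have hd0 : (0 : ℝ) < d := by exact_mod_cast hd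
  -- The radius is the largest for which the error `1600 * b * d * R` uses at most half of `κ * δ *
  -- s`. It may be 0; the bound by `2 * R + 1` still holds then.
  set R : ℕ := ⌊κ / (3200 * b * d) * δ * s⌋₊ with hR
  have hR1 : (R : ℝ) ≤ κ / (3200 * b * d) * δ * s := Nat.floor_le (by positivity)
  have hR2 : κ / (3200 * b * d) * δ * s ≤ 2 * R + 1 := by
    have := Nat.lt_floor_add_one (κ / (3200 * b * d) * δ * s)
    rw [← hR] at this
    linarith [(Nat.cast_nonneg R : (0 : ℝ) ≤ R)]
  have hc : κ / (800 * A) * s ≤ (κ * δ * s - 1600 * b * d * R) / (400 * A * δ) := by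
    rw [le_div_iff₀ (by positivity)]
    have h1 : 1600 * b * d * R ≤ 1600 * b * d * (κ / (3200 * b * d) * δ * s) :=
      mul_le_mul_of_nonneg_left hR1 (by positivity)
    have h2 : 1600 * b * d * (κ / (3200 * b * d) * δ * s) = κ * δ * s / 2 := by
      field_simp
      norm_num
    have h3 : κ / (800 * A) * s * (400 * A * δ) = κ * δ * s / 2 := by
      field_simp
      norm_num
    linarith
  have hu : ∀ u ∈ cube d R, ENNReal.ofReal (κ / (800 * A) * s) * environment d G (E) ≤
      ∫⁻ t, geodesicWeight q (0 + u) (v + u) t ∂environment d G := by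
    intro u hu
    refine le_trans (mul_le_mul_right (measure_mono_ae ?_) _)
      (mul_meas_ge_le_lintegral (measurable_geodesicWeight q (0 + u) (v + u)) _)
    filter_upwards [hpath] with t ht htE
    exact (ENNReal.ofReal_le_ofReal hc).trans (ht htE R u hu)
  have hsum := (Finset.card_nsmul_le_sum _ _ _ hu).trans
    (sum_lintegral_geodesicWeight_le ha hsupp q 0 v R)
  rw [card_cube, nsmul_eq_mul] at hsum
  have hfl : ((⌊b / a * (2 * d * R + 2)⌋₊ + 1 : ℕ) : ℝ≥0∞) ≤
      (2 * R + 1 : ℕ) * ENNReal.ofReal (b / a * (d + 2) + 1) := by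
    rw [← ENNReal.ofReal_natCast, ← ENNReal.ofReal_natCast,
      ← ENNReal.ofReal_mul (Nat.cast_nonneg _)]
    refine ENNReal.ofReal_le_ofReal ?_
    push_cast
    have h1 := Nat.floor_le (show 0 ≤ b / a * (2 * d * R + 2) by positivity)
    have h2 : 0 < b / a := by positivity
    have h3 : 0 ≤ b / a * ((R : ℝ) * 4 + d) := by positivity
    nlinarith [(Nat.cast_nonneg R : (0 : ℝ) ≤ R)]
  have h4 := hsum.trans (mul_le_mul_left hfl _)
  have h5 : ((2 * R + 1 : ℕ) : ℝ≥0∞) ≠ 0 := Nat.cast_ne_zero.2 (by omega)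
  have h6 : (((2 * R + 1) ^ d : ℕ) : ℝ≥0∞) =
      ((2 * R + 1 : ℕ) : ℝ≥0∞) * ((2 * R + 1 : ℕ) : ℝ≥0∞) ^ (d - 1) := by
    rw [← pow_succ', Nat.sub_add_cancel hd, Nat.cast_pow]
  -- The geodesic count is linear in `2 * R + 1` and cancels one of the `d` factors in the number of
  -- translates.
  rw [h6, mul_assoc, mul_assoc, ENNReal.mul_le_mul_iff_right h5 (ENNReal.natCast_ne_top _)] at h4
  refine le_trans ?_ h4
  rw [ENNReal.ofReal_mul (by positivity), mul_assoc]
  refine mul_le_mul_left ?_ _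
  rw [← ENNReal.ofReal_natCast, ← ENNReal.ofReal_pow (Nat.cast_nonneg _)]
  refine ENNReal.ofReal_le_ofReal (pow_le_pow_left₀ (by positivity) ?_ _)
  exact_mod_cast hR2

/-! ### Integrating a weak type function against a density -/

/-- A dyadic form of Young's inequality. -/
lemma mul_le_young {x w : ℝ≥0∞} (hx : x ≠ ⊤) :
    x * w ≤ 1 + 4 * w ^ 3 + ∑' k : ℕ, 4 * 8 ^ k * (if (4 : ℝ≥0∞) ^ k ≤ x then 1 else 0) := by
  rcases lt_or_ge x 1 with h1 | h1
  · refine le_trans ?_ le_self_add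
    have h2 : x * w ≤ w := by simpa using mul_le_mul_left h1.le w
    refine h2.trans ?_
    rcases le_total w 1 with hw | hw
    · exact hw.trans le_self_add
    · refine le_trans ?_ le_add_self
      calc w = 1 * w ^ 1 := by simp
        _ ≤ 4 * w ^ 3 := mul_le_mul' (by norm_num) (pow_le_pow_right₀ hw (by norm_num))
  · lift x to ℝ≥0 using hx
    -- At the scale `4 ^ k ≤ x < 4 ^ (k + 1)`, either `w ≤ 2 ^ k` and the dyadic term absorbs the
    -- product, or `x ≤ 4 * w ^ 2` and the cube does.
    obtain ⟨k, hk1, hk2⟩ := exists_nat_pow_near (show 1 ≤ x by exact_mod_cast h1)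
      (show (1 : ℝ≥0) < 4 by norm_num)
    have hk1' : (4 : ℝ≥0∞) ^ k ≤ x := by exact_mod_cast hk1
    have hk2' : (x : ℝ≥0∞) ≤ 4 * 4 ^ k := by
      rw [← pow_succ']
      exact_mod_cast hk2.le
    rcases le_total w (2 ^ k) with hw | hw
    · refine le_trans ?_ le_add_self
      refine le_trans ?_ (ENNReal.le_tsum k)
      rw [if_pos hk1', mul_one]
      calc (x : ℝ≥0∞) * w ≤ 4 * 4 ^ k * 2 ^ k := mul_le_mul' hk2' hw
        _ = 4 * 8 ^ k := by rw [mul_assoc, ← mul_pow]; norm_num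
    · refine le_trans ?_ le_self_add
      refine le_trans ?_ le_add_self
      calc (x : ℝ≥0∞) * w ≤ 4 * (2 ^ k * 2 ^ k) * w := by
            refine mul_le_mul_left (hk2'.trans_eq ?_) _
            rw [← mul_pow]; norm_num
        _ ≤ 4 * (w * w) * w := by gcongr
        _ = 4 * w ^ 3 := by ring

/-- Integration of a function with a weak type bound against a density with third moment. -/
lemma lintegral_mul_le_of_weak_type {Ω : Type*} [MeasurableSpace Ω] {m : Measure Ω}
    [IsProbabilityMeasure m] {X W : Ω → ℝ≥0∞} (hX : Measurable X) (hW : Measurable W)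
    {E : Set Ω} (hE : MeasurableSet E) (hfin : ∀ᵐ t ∂m, X t ≠ ⊤) (hW3 : ∫⁻ t, W t ^ 3 ∂m ≤ 2)
    {K : ℝ≥0∞} (hK1 : 1 ≤ K) (hK : ∀ᵐ t ∂m, t ∉ E → X t ≤ K) (hKE : K ^ 2 * m Eᶜ ≤ 1)
    (htail : ∀ k : ℕ, m (E ∩ {t | 4 ^ k ≤ X t}) ≤ ((16 : ℝ≥0∞) ^ k)⁻¹) :
    ∫⁻ t, X t * W t ∂m ≤ 20 := by
  classical
  have hS : ∀ k : ℕ, MeasurableSet (E ∩ {t | 4 ^ k ≤ X t}) := fun k =>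
    hE.inter (measurableSet_le measurable_const hX)
  have hterm : ∀ k : ℕ, Measurable fun t =>
      4 * 8 ^ k * (E ∩ {t | 4 ^ k ≤ X t}).indicator (1 : Ω → ℝ≥0∞) t := fun k =>
    (measurable_one.indicator (hS k)).const_mul _
  -- On `E` this is `mul_le_young`. Off `E`, where `X ≤ K`, the product is at most `K ^ 2` if `W ≤
  -- K`, and otherwise at most `W ^ 2 ≤ W ^ 3`.
  have hpt : ∀ᵐ t ∂m, X t * W t ≤ 1 + 5 * W t ^ 3 +
      (∑' k : ℕ, 4 * 8 ^ k * (E ∩ {t | 4 ^ k ≤ X t}).indicator (1 : Ω → ℝ≥0∞) t) +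
      K ^ 2 * Eᶜ.indicator (1 : Ω → ℝ≥0∞) t := by
    filter_upwards [hfin, hK] with t h1 h2
    by_cases ht : t ∈ E
    · refine (mul_le_young h1).trans ?_
      refine le_trans ?_ le_self_add
      refine add_le_add (add_le_add le_rfl (mul_le_mul_left (by norm_num) _)) ?_
      refine ENNReal.tsum_le_tsum fun k => mul_le_mul_right (le_of_eq ?_) _
      rw [Set.indicator_apply]
      simp [ht]
    · have h3 := h2 ht
      rw [Set.indicator_of_mem (show t ∈ Eᶜ from ht), Pi.one_apply, mul_one]
      rcases le_total (W t) K with hw | hw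
      · refine le_trans ?_ le_add_self
        rw [sq]
        exact mul_le_mul' h3 hw
      · refine le_trans ?_ le_self_add
        refine le_trans ?_ le_self_add
        refine le_trans ?_ le_add_self
        have hw1 : 1 ≤ W t := hK1.trans hw
        calc X t * W t ≤ W t * W t := mul_le_mul_left (h3.trans hw) _
          _ = 1 * W t ^ 2 := by ring
          _ ≤ 5 * W t ^ 3 := mul_le_mul' (by norm_num) (pow_le_pow_right₀ hw1 (by norm_num))
  refine (lintegral_mono_ae hpt).trans ?_
  rw [lintegral_add_right _ ((measurable_one.indicator hE.compl).const_mul _),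
    lintegral_add_right _ (Measurable.tsum hterm),
    lintegral_add_left measurable_const, lintegral_const_mul _ (hW.pow_const 3),
    lintegral_tsum fun k => (hterm k).aemeasurable,
    lintegral_const_mul _ (measurable_one.indicator hE.compl), lintegral_indicator_one hE.compl,
    lintegral_one, measure_univ]
  -- The tail `16 ^ (-k)` beats `8 ^ k` and leaves a geometric series of ratio `1 / 2`.
  have hgeom : ∑' k : ℕ, ∫⁻ t, 4 * 8 ^ k * (E ∩ {t | 4 ^ k ≤ X t}).indicator (1 : Ω → ℝ≥0∞) t ∂m ≤
      8 := by
    have h1 : ∀ k : ℕ, ∫⁻ t, 4 * 8 ^ k *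
        (E ∩ {t | 4 ^ k ≤ X t}).indicator (1 : Ω → ℝ≥0∞) t ∂m ≤ 4 * (2 : ℝ≥0∞)⁻¹ ^ k := by
      intro k
      rw [lintegral_const_mul _ (measurable_one.indicator (hS k)), lintegral_indicator_one (hS k),
        mul_assoc]
      refine mul_le_mul_right ?_ _
      calc (8 : ℝ≥0∞) ^ k * m (E ∩ {t | 4 ^ k ≤ X t}) ≤ 8 ^ k * ((16 : ℝ≥0∞) ^ k)⁻¹ :=
            mul_le_mul_right (htail k) _
        _ = (8 * (16 : ℝ≥0∞)⁻¹) ^ k := by rw [ENNReal.inv_pow, mul_pow]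
        _ = (2 : ℝ≥0∞)⁻¹ ^ k := by
            congr 1
            rw [show (16 : ℝ≥0∞) = 8 * 2 by norm_num,
              ENNReal.mul_inv (Or.inl (by norm_num)) (Or.inl (by norm_num)), ← mul_assoc,
              ENNReal.mul_inv_cancel (by norm_num) (by norm_num), one_mul]
    refine (ENNReal.tsum_le_tsum h1).trans ?_
    rw [ENNReal.tsum_mul_left, ENNReal.tsum_geometric, ENNReal.one_sub_inv_two, inv_inv]
    norm_num
  calc _ ≤ (1 : ℝ≥0∞) + 5 * 2 + 8 + 1 := by
        refine add_le_add (add_le_add (add_le_add le_rfl ?_) hgeom) hKE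
        exact mul_le_mul_right hW3 _
    _ = 20 := by norm_num

/-! ### Boxes and numerical estimates -/

lemma toEuclid_zero : toEuclid (0 : Fin d → ℤ) = 0 := by
  ext i
  simp [toEuclid]

lemma norm_toEuclid_le (v : Fin d → ℤ) : ‖toEuclid v‖ ≤ l1dist 0 v := by
  have := norm_toEuclid_sub_le v 0
  rwa [toEuclid_zero, sub_zero, l1dist_comm] at this

lemma l1dist_zero_le (v : Fin d → ℤ) : (l1dist 0 v : ℝ) ≤ d * ‖toEuclid v‖ := by
  rw [l1dist, Nat.cast_sum]
  have h : ∀ i ∈ (Finset.univ : Finset (Fin d)),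
      (((((0 : Fin d → ℤ) i - v i).natAbs : ℕ) : ℝ)) ≤ ‖toEuclid v‖ := by
    intro i _
    have h1 := PiLp.norm_apply_le (toEuclid v) i
    refine le_trans (le_of_eq ?_) h1
    rw [Nat.cast_natAbs, Int.cast_abs, Real.norm_eq_abs]
    simp [toEuclid]
  simpa using Finset.sum_le_card_nsmul _ _ _ h

lemma mem_cube_of_l1dist_le {R : ℕ} {x : Fin d → ℤ} (h : l1dist 0 x ≤ R) : x ∈ cube d R := by
  have h1 : ∀ i, (x i).natAbs ≤ R := fun i => by
    refine le_trans ?_ h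
    have := Finset.single_le_sum (f := fun i => ((0 : Fin d → ℤ) i - x i).natAbs)
      (fun _ _ => Nat.zero_le _) (Finset.mem_univ i)
    simpa [l1dist] using this
  rw [cube, Finset.mem_Icc]
  constructor <;> intro i <;> have := h1 i
  · show -(R : ℤ) ≤ x i
    omega
  · show x i ≤ R
    omega

lemma getVert_mem_cube {v : Fin d → ℤ} (p : (lattice d).Walk 0 v) {R : ℕ} (hR : p.length ≤ R)
    {i : ℕ} (hi : i ≤ p.length) : p.getVert i ∈ cube d R := by
  refine mem_cube_of_l1dist_le ?_
  have := l1dist_getVert_le p 0 i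
  rw [SimpleGraph.Walk.getVert_zero, zero_add] at this
  omega

open Classical in
/-- A finite set of edges containing all edges between points of a box. -/
noncomputable def boxEdges (d R : ℕ) : Finset (Edge d) :=
  (cube d R ×ˢ Finset.univ).image fun z => stepEdge z.1 z.2

lemma mem_boxEdges {v : Fin d → ℤ} (p : (lattice d).Walk 0 v) {R : ℕ} (hR : p.length ≤ R)
    {e : Edge d} (he : e ∈ walkEdges p) : e ∈ boxEdges d R := by
  obtain ⟨i, hi, rfl⟩ := List.mem_iff_getElem.1 he
  have hi' : i < p.length := by simpa using hi
  obtain ⟨s, hs⟩ := lattice_adj_iff_exists_step.1 (p.adj_getVert_succ hi')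
  refine Finset.mem_image.2 ⟨(p.getVert i, s), ?_, ?_⟩
  · exact Finset.mem_product.2 ⟨getVert_mem_cube p hR hi'.le, Finset.mem_univ _⟩
  · refine Subtype.ext ?_
    rw [walkEdges_getElem, hs]
    rfl

/-- The exponential is of order `n ^ (-(d + 3))`, one power of `n` more than the other factors
require; rounding `Real.log n` down costs `Real.exp (d + 3)`. -/
lemma exceptional_bound {c n : ℝ} (hc : 1 ≤ c) (hn : 1 ≤ n)
    (hn2 : 5 ^ d * c ^ (d + 2) * Real.exp (d + 3) ≤ n) :
    (c * n) ^ 2 * ((2 * (⌈c * n⌉₊ : ℝ) + 1) ^ d * Real.exp (-(d + 3)) ^ ⌊Real.log n⌋₊) ≤ 1 := by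
  have hn0 : 0 < n := by linarith
  have hcn : 1 ≤ c * n := by nlinarith
  have h1 : 2 * (⌈c * n⌉₊ : ℝ) + 1 ≤ 5 * (c * n) := by
    have := Nat.ceil_lt_add_one (show 0 ≤ c * n by linarith)
    linarith
  have h2 : Real.exp (-(d + 3)) ^ ⌊Real.log n⌋₊ ≤ Real.exp (d + 3) / n ^ (d + 3) := by
    have h3 := Nat.lt_floor_add_one (Real.log n)
    have h4 : n ^ (d + 3) = Real.exp ((d + 3) * Real.log n) := by
      rw [mul_comm, Real.exp_mul, Real.exp_log hn0]
      exact_mod_cast (Real.rpow_natCast n (d + 3)).symm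
    rw [h4, ← Real.exp_sub, ← Real.exp_nat_mul]
    refine Real.exp_le_exp.2 ?_
    have : (0 : ℝ) ≤ d := Nat.cast_nonneg d
    nlinarith
  calc (c * n) ^ 2 * ((2 * (⌈c * n⌉₊ : ℝ) + 1) ^ d * Real.exp (-(d + 3)) ^ ⌊Real.log n⌋₊)
      ≤ (c * n) ^ 2 * ((5 * (c * n)) ^ d * (Real.exp (d + 3) / n ^ (d + 3))) := by gcongr
    _ = (5 ^ d * c ^ (d + 2) * Real.exp (d + 3)) / n := by
        rw [mul_pow 5, mul_pow c n d]
        field_simp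
        ring
    _ ≤ 1 := by rwa [div_le_one hn0]

/-- Almost sure properties persist under a shift with non-vanishing density. -/
lemma ae_shift {Ω : Type*} [MeasurableSpace Ω] {m : Measure Ω} {T : Ω → Ω} {W : Ω → ℝ≥0∞}
    (hT : Measurable T) (hW : Measurable W) (hW0 : ∀ t, W t ≠ 0)
    (h : ∀ f : Ω → ℝ≥0∞, Measurable f → ∫⁻ t, f t ∂m = ∫⁻ t, f (T t) * W t ∂m) {P : Ω → Prop}
    (hP : ∀ᵐ t ∂m, P t) : ∀ᵐ t ∂m, P (T t) := by
  obtain ⟨Z, hZ, hZm, hZ0⟩ := exists_measurable_superset_of_null (ae_iff.1 hP)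
  have h1 := h _ (measurable_one.indicator hZm)
  rw [lintegral_indicator_one hZm, hZ0] at h1
  have h2 := (lintegral_eq_zero_iff (((measurable_one.indicator hZm).comp hT).mul hW)).1 h1.symm
  filter_upwards [h2] with t ht
  by_contra hn
  have h3 : T t ∈ Z := hZ hn
  simp only [Pi.mul_apply, Function.comp_apply, Set.indicator_of_mem h3, Pi.one_apply, one_mul,
    Pi.zero_apply] at ht
  exact hW0 t ht

lemma prod_one_add_le_two {ι : Type*} (s : Finset ι) (x : ι → ℝ) (hx : ∀ i, 0 ≤ x i)
    (hs : ∑ i ∈ s, x i ≤ 1 / 4) : ∏ i ∈ s, ENNReal.ofReal (1 + x i) ≤ 2 := by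
  rw [← ENNReal.ofReal_prod_of_nonneg fun i _ => by linarith [hx i],
    show (2 : ℝ≥0∞) = ENNReal.ofReal 2 by norm_num]
  refine ENNReal.ofReal_le_ofReal ?_
  calc ∏ i ∈ s, (1 + x i) ≤ ∏ i ∈ s, Real.exp (x i) :=
        Finset.prod_le_prod (fun i _ => by linarith [hx i])
          fun i _ => by linarith [Real.add_one_le_exp (x i)]
    _ = Real.exp (∑ i ∈ s, x i) := (Real.exp_sum _ _).symm
    _ ≤ Real.exp (Real.log 2) := Real.exp_le_exp.2 (by linarith [Real.log_two_gt_d9])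
    _ = 2 := Real.exp_log two_pos

lemma tsum_sq_le_sq_tsum {ι : Type*} (q : ι → ℝ≥0) :
    ∑' e, (q e : ℝ≥0∞) ^ 2 ≤ (∑' e, (q e : ℝ≥0∞)) ^ 2 := by
  rw [sq (∑' e, (q e : ℝ≥0∞)), ← ENNReal.tsum_mul_left]
  refine ENNReal.tsum_le_tsum fun e => ?_
  rw [sq]
  exact mul_le_mul_left (ENNReal.le_tsum e) _

lemma sum_sq_le_toReal {ι : Type*} (q : ι → ℝ≥0) (h : ∑' e, (q e : ℝ≥0∞) ^ 2 ≠ ⊤) (s : Finset ι) :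
    ∑ e ∈ s, (q e : ℝ) ^ 2 ≤ (∑' e, (q e : ℝ≥0∞) ^ 2).toReal := by
  have h1 := ENNReal.toReal_mono h (ENNReal.sum_le_tsum (f := fun e => (q e : ℝ≥0∞) ^ 2) s)
  rw [ENNReal.toReal_sum fun e _ => by simp] at h1
  simpa using h1

/-! ### The main estimate and its transfer to arbitrary environments -/

/-- The bound for a canonical environment and `q` with finite nonzero total mass. -/
theorem exists_lintegral_geodesicWeight_pow_le (hd : 2 ≤ d) {G : Measure ℝ}
    [IsProbabilityMeasure G] (hG : IsAdmissible G) :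
    ∃ (C : ℝ) (n₀ : ℝ), 0 < C ∧ ∀ v : Fin d → ℤ, n₀ ≤ ‖toEuclid v‖ →
      ∀ q : Edge d → ℝ≥0, IsLogSmooth ‖toEuclid v‖ q → ∑' e, (q e : ℝ≥0∞) ≠ ⊤ →
        ∑' e, (q e : ℝ≥0∞) ≠ 0 →
        ∃ S : ℝ, 0 ≤ S ∧ ∫⁻ t, geodesicWeight q 0 v t ∂environment d G ≤ ENNReal.ofReal S ∧
          S ^ d ≤ C * √(∑' e, (q e : ℝ≥0∞) ^ 2).toReal ^ (d - 1) *
            (∑' e, (q e : ℝ≥0∞)).toReal := by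
  classical
  obtain ⟨a, b, α, ha, hab, hα, hsupp, ρ, -, hGρ, hρ⟩ := hG
  have hac : G ≪ volume := hGρ ▸ withDensity_absolutelyContinuous _ _
  have hna : NullSingletonClass G := ⟨fun x => hac (by simp)⟩
  obtain ⟨φ, w, A, hA, hshift, hgood⟩ := exists_site_shift hab hα hsupp hGρ hρ
  have hb : 0 < b := ha.trans hab
  have hd1 : 1 ≤ d := by omega
  have hd0 : (0 : ℝ) < d := by exact_mod_cast hd1
  set c : ℝ := b / a * d with hc
  have hc1 : 1 ≤ c := by
    have h1 : 1 ≤ b / a := (one_le_div ha).2 hab.le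
    have h2 : (1 : ℝ) ≤ d := by exact_mod_cast hd1
    nlinarith
  -- Chosen so that `4 * d * η` is exactly the base `Real.exp (-(d + 3))` of `exceptional_bound`.
  set η : ℝ≥0∞ := ENNReal.ofReal (Real.exp (-(d + 3)) / (4 * d)) with hη
  have hη1 : η ≤ 1 := by
    rw [hη, ← ENNReal.ofReal_one]
    refine ENNReal.ofReal_le_ofReal ((div_le_one (by positivity)).2 ?_)
    have h1 : Real.exp (-(d + 3)) ≤ 1 := Real.exp_le_one_iff.2 (by linarith)
    have h2 : (1 : ℝ) ≤ d := by exact_mod_cast hd1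
    linarith
  have hη0 : 0 < η ^ 2 :=
    pos_iff_ne_zero.2 (pow_ne_zero 2 (ENNReal.ofReal_pos.2 (by positivity)).ne')
  obtain ⟨κ, B, hκ, hBm, hGB, hκB⟩ := hgood (η ^ 2) hη0
  set C₂ : ℝ := b / a * (d + 2) + 1 with hC₂
  have hC₂0 : 0 < C₂ := by positivity
  set c₁ : ℝ := κ / (800 * A) with hc₁
  have hc₁0 : 0 < c₁ := by positivity
  set c₄ : ℝ := κ / (3200 * b * d) with hc₄
  have hc₄0 : 0 < c₄ := by positivity
  -- The first entry normalizes the weak type bound to constant one; the second ensures `D ≤ M`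
  -- below.
  set C₆ : ℝ := max (C₂ / (c₄ ^ (d - 1) * c₁)) 1 with hC₆
  have hC₆1 : 1 ≤ C₆ := le_max_right _ _
  refine ⟨20 ^ d * (C₆ * 2 ^ (d - 1)), max 3 (5 ^ d * c ^ (d + 2) * Real.exp (d + 3)),
    by positivity, fun v hv q hq hσt hσ0 => ?_⟩
  set n : ℝ := ‖toEuclid v‖ with hn
  have hn3 : 3 ≤ n := (le_max_left _ _).trans hv
  have hn2 : 5 ^ d * c ^ (d + 2) * Real.exp (d + 3) ≤ n := (le_max_right _ _).trans hv
  -- the normalization of `q`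
  set σ : ℝ := (∑' e, (q e : ℝ≥0∞)).toReal with hσ
  have hσpos : 0 < σ := ENNReal.toReal_pos hσ0 hσt
  have hst : ∑' e, (q e : ℝ≥0∞) ^ 2 ≠ ⊤ :=
    ne_top_of_le_ne_top (ENNReal.pow_ne_top hσt) (tsum_sq_le_sq_tsum q)
  set D : ℝ := √(∑' e, (q e : ℝ≥0∞) ^ 2).toReal with hD
  have hDsq : D ^ 2 = (∑' e, (q e : ℝ≥0∞) ^ 2).toReal := Real.sq_sqrt ENNReal.toReal_nonneg
  have hDσ : D ≤ σ := by
    refine Real.sqrt_le_iff.2 ⟨hσpos.le, ?_⟩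
    rw [hσ, ← ENNReal.toReal_pow]
    exact ENNReal.toReal_mono (ENNReal.pow_ne_top hσt) (tsum_sq_le_sq_tsum q)
  have hDsum : ∀ s : Finset (Edge d), ∑ e ∈ s, (q e : ℝ) ^ 2 ≤ D ^ 2 := fun s =>
    hDsq ▸ sum_sq_le_toReal q hst s
  have hD0 : 0 < D := by
    refine Real.sqrt_pos.2 (ENNReal.toReal_pos (fun h => hσ0 ?_) hst)
    rw [ENNReal.tsum_eq_zero] at h ⊢
    exact fun e => by simpa using h e
  have hqD : ∀ e, (q e : ℝ) ≤ D := fun e => by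
    have := hDsum {e}
    rw [Finset.sum_singleton] at this
    exact (pow_le_pow_iff_left₀ (NNReal.coe_nonneg _) hD0.le two_ne_zero).1 this
  -- The largest `δ` with `∑ (δ * q e) ^ 2 ≤ 1 / 4`; it also keeps every shift parameter at most `1
  -- / 2`.
  set δ : ℝ := 1 / (2 * D) with hδ
  have hδ0 : 0 < δ := by positivity
  have hδD : δ * (2 * D) = 1 := by rw [hδ]; field_simp
  have hτ0 : ∀ e, 0 ≤ δ * q e := fun e => mul_nonneg hδ0.le (NNReal.coe_nonneg _)
  have hτ1 : ∀ e, δ * q e ≤ 1 / 2 := fun e => by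
    have := mul_le_mul_of_nonneg_left (hqD e) hδ0.le
    linarith
  have hsite := fun e : Edge d => hshift (δ * q e) (hτ0 e) (hτ1 e)
  -- the box containing the geodesics
  set R₀ : ℕ := ⌈c * n⌉₊ with hR₀
  set L : ℕ := ⌊Real.log n⌋₊ with hL
  have hlog : 1 ≤ Real.log n := by
    rw [Real.le_log_iff_exp_le (by linarith)]
    linarith [Real.exp_one_lt_d9]
  have hL0 : 0 < L := Nat.floor_pos.2 hlog
  have hLn : (L : ℝ) ≤ Real.log n := Nat.floor_le (by linarith)
  -- Finitely many shifted coordinates suffice: the shifted weights stay in `[a, b]`, so the shifted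
  -- geodesic has at most `c * n` edges and remains in this box.
  set Λ := boxEdges d R₀ with hΛ
  set T : (Edge d → ℝ) → (Edge d → ℝ) := fun t e => if e ∈ Λ then φ (δ * q e) (t e) else t e with hT
  set W : (Edge d → ℝ) → ℝ≥0∞ := fun t => ∏ e ∈ Λ, w (δ * q e) (t e) with hW
  have hTm : Measurable T := by
    refine measurable_pi_iff.2 fun e => ?_
    simp only [hT]
    split_ifs
    · exact (hsite e).measurable_map.comp (measurable_pi_apply e)
    · exact measurable_pi_apply e
  have hWm : Measurable W := Finset.measurable_prod _ fun e _ =>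
    (hsite e).measurable_density.comp (measurable_pi_apply e)
  have hW0 : ∀ t, W t ≠ 0 := fun t =>
    Finset.prod_ne_zero_iff.2 fun e _ => (hsite e).density_ne_zero _
  have hcov : ∀ f : (Edge d → ℝ) → ℝ≥0∞, Measurable f →
      ∫⁻ t, f t ∂environment d G = ∫⁻ t, f (T t) * W t ∂environment d G := fun f hf =>
    lintegral_shift_infinitePi G (fun e => φ (δ * q e)) (fun e => w (δ * q e))
      (fun e => (hsite e).measurable_map) (fun e => (hsite e).measurable_density)
      (fun e => (hsite e).lintegral_eq) Λ hf
  have hW3 : ∫⁻ t, W t ^ 3 ∂environment d G ≤ 2 := by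
    refine (lintegral_prod_pow_infinitePi G (fun e => w (δ * q e))
      (fun e => (hsite e).measurable_density) 3 Λ).trans_le ?_
    refine (Finset.prod_le_prod' fun e _ => (hsite e).lintegral_cube_le).trans ?_
    refine prod_one_add_le_two Λ _ (fun e => sq_nonneg _) ?_
    simp only [mul_pow, ← Finset.mul_sum]
    have h1 := mul_le_mul_of_nonneg_left (hDsum Λ) (sq_nonneg δ)
    have h2 : (δ * D) ^ 2 = 1 / 4 := by
      rw [show δ * D = 1 / 2 by linarith]; norm_num
    rw [mul_pow] at h2
    linarith
  -- the geodesic in the shifted environment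
  have hTmem : ∀ t : Edge d → ℝ, (∀ e, t e ∈ Set.Icc a b) → ∀ e, T t e ∈ Set.Icc a b := by
    intro t ht e
    simp only [hT]
    split_ifs
    · exact (hsite e).map_mem _ (ht e)
    · exact ht e
  have hTle : ∀ t : Edge d → ℝ, ∀ e, t e ≤ T t e ∧ T t e ≤ t e + A * (δ * q e) := by
    intro t e
    simp only [hT]
    split_ifs
    · exact (hsite e).le_map _
    · exact ⟨le_rfl, le_add_of_nonneg_right (mul_nonneg hA.le (hτ0 e))⟩
  have hgeo : ∀ᵐ t ∂environment d G, (∀ e, t e ∈ Set.Icc a b) ∧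
      ∃ p : (lattice d).Walk 0 v, IsGeodesic (T t) p ∧ (walkEdges p).Nodup ∧
        (p.length : ℝ) ≤ c * n ∧
        geodesicWeight q 0 v (T t) = ((((walkEdges p).map q).sum : ℝ≥0) : ℝ≥0∞) := by
    filter_upwards [ae_mem_Icc hsupp, ae_shift hTm hWm hW0 hcov (ae_geodesicEdges_eq G 0 v)]
      with t ht hu
    have ht' := hTmem t ht
    obtain ⟨p, hp⟩ := exists_isGeodesic ha (fun e => (ht' e).1) 0 v
    have hnd := hp.nodup_walkEdges ha (fun e => (ht' e).1) (fun e => (ht' e).2)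
    refine ⟨ht, p, hp, hnd, ?_, geodesicWeight_eq q (hu p hp) hnd⟩
    have h1 := hp.length_mul_le (fun e => (ht' e).1) (fun e => (ht' e).2)
    have h2 := mul_le_mul_of_nonneg_left (l1dist_zero_le v) hb.le
    rw [hc, div_mul_eq_mul_div, div_mul_eq_mul_div, le_div_iff₀ ha]
    linarith
  have hcoe : ∀ {x y : Fin d → ℤ} (p : (lattice d).Walk x y),
      ((((walkEdges p).map q).sum : ℝ≥0) : ℝ) = ((walkEdges p).map fun e => (q e : ℝ)).sum := by
    intro x y p
    rw [NNReal.coe_list_sum, List.map_map]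
    rfl
  -- the scale of the weight
  have hX0 : 0 ≤ C₆ * σ * (2 * D) ^ (d - 1) := by positivity
  -- `M` is the natural scale of the weight: the weak type bound at level `4 ^ k * M` reads at most
  -- `4 ^ (-k * d)`.
  obtain ⟨M, hM0, hM⟩ : ∃ M : ℝ, 0 ≤ M ∧ M ^ d = C₆ * σ * (2 * D) ^ (d - 1) :=
    ⟨_, Real.rpow_nonneg hX0 _, Real.rpow_inv_natCast_pow hX0 (by omega)⟩
  have hDM : D ≤ M := by
    refine (pow_le_pow_iff_left₀ hD0.le hM0 (by omega : d ≠ 0)).1 ?_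
    rw [hM]
    calc D ^ d = 1 * D * (1 * D) ^ (d - 1) := by
          rw [one_mul, ← pow_succ', Nat.sub_add_cancel hd1]
      _ ≤ C₆ * σ * (2 * D) ^ (d - 1) := by gcongr; norm_num
  have hMpos : 0 < M := hD0.trans_le hDM
  set E : Set (Edge d → ℝ) := (exceptionalEvent B L R₀)ᶜ with hE
  have hEm : MeasurableSet E := (measurableSet_exceptionalEvent hBm L R₀).compl
  have hMt : ENNReal.ofReal M ≠ 0 := (ENNReal.ofReal_pos.2 hMpos).ne'
  have hdiv : ∀ (x : ℝ≥0∞) (s : ℝ), 0 ≤ s → (ENNReal.ofReal s ≤ x / ENNReal.ofReal M ↔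
      ENNReal.ofReal (s * M) ≤ x) := fun x s hs => by
    rw [ENNReal.le_div_iff_mul_le (Or.inl hMt) (Or.inl ENNReal.ofReal_ne_top),
      ENNReal.ofReal_mul hs]
  have hpath : ∀ s : ℝ, ∀ᵐ t ∂environment d G,
      t ∈ E ∩ {t | ENNReal.ofReal s ≤ geodesicWeight q 0 v (T t)} → ∀ R : ℕ, ∀ u ∈ cube d R,
        ENNReal.ofReal ((κ * δ * s - 1600 * b * d * R) / (400 * A * δ)) ≤
          geodesicWeight q (0 + u) (v + u) t := by
    intro s
    filter_upwards [hgeo] with t ⟨ht, p, hp, hnd, hlen, hwt⟩ ⟨htE, hts⟩ R u hu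
    obtain ⟨p₀, hp₀⟩ := exists_isGeodesic ha (fun e => (ht e).1) (0 + u) (v + u)
    have hnd₀ := hp₀.nodup_walkEdges ha (fun e => (ht e).1) (fun e => (ht e).2)
    refine le_trans ?_ (sum_le_geodesicWeight q hp₀ hnd₀)
    have hlenR : p.length ≤ R₀ := by exact_mod_cast hlen.trans (Nat.le_ceil _)
    have hLp : L ≤ p.length := by
      have h1 : (L : ℝ) ≤ n := hLn.trans (Real.log_le_self (by linarith))
      have h2 : n ≤ l1dist 0 v := norm_toEuclid_le v
      have h3 := l1dist_le_length p
      have h4 : (l1dist 0 v : ℝ) ≤ p.length := by exact_mod_cast h3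
      exact_mod_cast (h1.trans h2).trans h4
    have hsum := sum_walkEdges_le_sum_good hL0 htE p hnd hLp
      (fun i hi => getVert_mem_cube p hlenR hi) hLn hq
    have hmain := weight_le_weight_translate (A := A) (κ := κ) (δ := δ) (b := b) hκ.le hδ0.le hb.le
      ht (hTmem t ht) (hTle t) hp (fun e he heB => by
        simp only [hT, if_pos (mem_boxEdges p hlenR he), hΛ]
        exact hκB _ (hτ0 e) (hτ1 e) _ heB) hsum hu hp₀
    have hts' : ENNReal.ofReal s ≤ geodesicWeight q 0 v (T t) := hts
    rw [hwt, ENNReal.ofReal_le_iff_le_toReal ENNReal.coe_ne_top, ENNReal.coe_toReal, hcoe] at hts'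
    rw [ENNReal.ofReal_le_iff_le_toReal ENNReal.coe_ne_top, ENNReal.coe_toReal, hcoe,
      div_le_iff₀ (by positivity)]
    have h5 := mul_le_mul_of_nonneg_left hts' (mul_nonneg hκ.le hδ0.le)
    linarith
  have hNm : Measurable fun t => geodesicWeight q 0 v (T t) / ENNReal.ofReal M :=
    ((measurable_geodesicWeight q 0 v).comp hTm).div_const _
  have hNWm : Measurable fun t => geodesicWeight q 0 v (T t) / ENNReal.ofReal M * W t :=
    hNm.mul hWm
  have hmain : ∫⁻ t, geodesicWeight q 0 v (T t) / ENNReal.ofReal M * W t ∂environment d G ≤ 20 := by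
    refine lintegral_mul_le_of_weak_type hNm hWm hEm ?_ hW3 (K := ENNReal.ofReal (c * n)) ?_ ?_ ?_ ?_
    · filter_upwards [hgeo] with t ⟨_, p, _, _, _, hwt⟩
      rw [hwt]
      exact ENNReal.div_ne_top ENNReal.coe_ne_top hMt
    · rw [← ENNReal.ofReal_one]
      exact ENNReal.ofReal_le_ofReal (by nlinarith)
    -- The crude bound on the exceptional event: at most `c * n` edges, each of weight at most `D ≤
    -- M`.
    · filter_upwards [hgeo] with t ⟨_, p, _, _, hlen, hwt⟩ _
      refine ENNReal.div_le_of_le_mul ?_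
      rw [hwt, ← ENNReal.ofReal_mul (by positivity), ← ENNReal.ofReal_coe_nnreal, hcoe]
      refine ENNReal.ofReal_le_ofReal ?_
      have h1 := List.sum_le_card_nsmul ((walkEdges p).map fun e => (q e : ℝ)) D fun z hz => by
        obtain ⟨e, -, rfl⟩ := List.mem_map.1 hz
        exact hqD e
      rw [List.length_map, length_walkEdges, nsmul_eq_mul] at h1
      refine h1.trans (mul_le_mul hlen hDM hD0.le (by positivity))
    · rw [hE, compl_compl]
      refine (mul_le_mul_right (measure_exceptionalEvent_le G hBm hη1 hGB L R₀) _).trans ?_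
      have h1 : (4 : ℝ≥0∞) * d * η = ENNReal.ofReal (Real.exp (-(d + 3))) := by
        rw [hη, show (4 : ℝ≥0∞) * d = ENNReal.ofReal (4 * d) by
          rw [ENNReal.ofReal_mul (by norm_num), ENNReal.ofReal_natCast]; norm_num,
          ← ENNReal.ofReal_mul (by positivity)]
        congr 1
        field_simp
      rw [h1, ← ENNReal.ofReal_natCast, ← ENNReal.ofReal_pow (by positivity),
        ← ENNReal.ofReal_pow (by positivity), ← ENNReal.ofReal_mul (by positivity),
        ← ENNReal.ofReal_mul (by positivity), ← ENNReal.ofReal_one]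
      refine ENNReal.ofReal_le_ofReal ?_
      push_cast
      exact exceptional_bound hc1 (by linarith) hn2
    · intro k
      set s : ℝ := 4 ^ k * M with hs
      have hs0 : 0 < s := by positivity
      have hset : E ∩ {t | 4 ^ k ≤ geodesicWeight q 0 v (T t) / ENNReal.ofReal M} =
          E ∩ {t | ENNReal.ofReal s ≤ geodesicWeight q 0 v (T t)} := by
        ext t
        refine and_congr_right fun _ => ?_
        have := hdiv (geodesicWeight q 0 v (T t)) (4 ^ k) (by positivity)
        rw [ENNReal.ofReal_pow (by norm_num), ENNReal.ofReal_ofNat] at this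
        exact this
      rw [hset]
      have hweak := weak_type_bound hd1 ha hb hsupp hA hκ hδ0 q v _ hs0 (hpath s)
      set m : ℝ≥0∞ := environment d G
        (E ∩ {t | ENNReal.ofReal s ≤ geodesicWeight q 0 v (T t)}) with hm
      have hmt : m ≠ ⊤ := measure_ne_top _ _
      rw [← ENNReal.ofReal_toReal hmt, ← ENNReal.ofReal_toReal hσt,
        ← ENNReal.ofReal_mul (by positivity), ← ENNReal.ofReal_mul (by positivity),
        ENNReal.ofReal_le_ofReal_iff (by positivity)] at hweak
      -- Here `2 ≤ d` is essential: it makes the tail at least quadratic.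
      have h16 : (16 : ℝ) ^ k ≤ (4 ^ k) ^ d := by
        rw [← pow_mul, show (16 : ℝ) = 4 ^ 2 by norm_num, ← pow_mul]
        refine pow_le_pow_right₀ (by norm_num) ?_
        rw [mul_comm]
        exact Nat.mul_le_mul_left k hd
      have hC : C₂ ≤ c₄ ^ (d - 1) * c₁ * C₆ := by
        rw [← div_le_iff₀' (by positivity)]
        exact le_max_left _ _
      have hexp : (c₄ * δ * s) ^ (d - 1) * (c₁ * s) =
          (c₄ ^ (d - 1) * c₁ * C₆) * σ * (4 ^ k) ^ d := by
        calc (c₄ * δ * s) ^ (d - 1) * (c₁ * s)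
            = c₄ ^ (d - 1) * c₁ * δ ^ (d - 1) * (s ^ (d - 1) * s) := by
              rw [mul_pow, mul_pow]; ring
          _ = c₄ ^ (d - 1) * c₁ * δ ^ (d - 1) * ((4 ^ k) ^ d * M ^ d) := by
              rw [← pow_succ, Nat.sub_add_cancel hd1, hs, mul_pow]
          _ = (c₄ ^ (d - 1) * c₁ * C₆) * σ * (4 ^ k) ^ d * (δ * (2 * D)) ^ (d - 1) := by
              rw [hM, mul_pow δ]; ring
          _ = _ := by rw [hδD, one_pow, mul_one]
      rw [hexp] at hweak
      have hfin : (16 : ℝ) ^ k * m.toReal ≤ 1 := by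
        have h1 : C₂ * σ * (16 ^ k * m.toReal) ≤ C₂ * σ * 1 := by
          calc C₂ * σ * (16 ^ k * m.toReal)
              ≤ (c₄ ^ (d - 1) * c₁ * C₆) * σ * ((4 ^ k) ^ d * m.toReal) := by gcongr
            _ = (c₄ ^ (d - 1) * c₁ * C₆) * σ * (4 ^ k) ^ d * m.toReal := by ring
            _ ≤ C₂ * σ * 1 := by rw [mul_one]; exact hweak
        exact le_of_mul_le_mul_left h1 (by positivity)
      rw [← ENNReal.ofReal_toReal hmt, ENNReal.le_inv_iff_mul_le,
        show (16 : ℝ≥0∞) ^ k = ENNReal.ofReal (16 ^ k) by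
          rw [ENNReal.ofReal_pow (by norm_num), ENNReal.ofReal_ofNat],
        ← ENNReal.ofReal_mul ENNReal.toReal_nonneg, ← ENNReal.ofReal_one]
      exact ENNReal.ofReal_le_ofReal (by rwa [mul_comm])
  refine ⟨20 * M, by positivity, ?_, ?_⟩
  · rw [hcov _ (measurable_geodesicWeight q 0 v)]
    have h1 : ∀ t, geodesicWeight q 0 v (T t) * W t =
        ENNReal.ofReal M * (geodesicWeight q 0 v (T t) / ENNReal.ofReal M * W t) := fun t => by
      rw [← mul_assoc, ENNReal.mul_div_cancel hMt ENNReal.ofReal_ne_top]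
    simp only [h1]
    rw [lintegral_const_mul _ hNWm, mul_comm 20 M, ENNReal.ofReal_mul hM0]
    refine mul_le_mul_right (hmain.trans_eq ?_) _
    norm_num
  · rw [mul_pow, hM, mul_pow]
    exact le_of_eq (by ring)

end FPP

theorem proposition4p1 (d : ℕ) (hd : 2 ≤ d) (G : Measure ℝ) [IsProbabilityMeasure G]
    (hG : FPP.IsAdmissible G) :
    ∃ (C : ℝ≥0) (n₀ : ℝ), ∀ (Ω : Type*) [MeasurableSpace Ω] (P : Measure Ω)
      [IsProbabilityMeasure P] (t : FPP.Edge d → Ω → ℝ), FPP.IsIIDEnvironment P t G →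
      ∀ v : Fin d → ℤ, n₀ ≤ ‖FPP.toEuclid v‖ →
      ∀ q : FPP.Edge d → ℝ≥0, FPP.IsLogSmooth ‖FPP.toEuclid v‖ q →
        (∑' e, (q e : ℝ≥0∞) * FPP.geodesicProb P t v e) ^ d ≤
          (C : ℝ≥0∞) * (∑' e, (q e : ℝ≥0∞) ^ 2) ^ (((d : ℝ) - 1) / 2) * ∑' e, (q e : ℝ≥0∞) := by
  obtain ⟨C, n₀, hC, h⟩ := FPP.exists_lintegral_geodesicWeight_pow_le hd hG
  refine ⟨C.toNNReal, n₀, fun Ω _ P _ t ht v hv q hq => ?_⟩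
  have hd1 : (1 : ℝ) < d := by exact_mod_cast hd
  have hexp : 0 < ((d : ℝ) - 1) / 2 := by linarith
  by_cases h0 : ∑' e, (q e : ℝ≥0∞) = 0
  · rw [ENNReal.tsum_eq_zero] at h0
    simp [h0, show d ≠ 0 by omega]
  have hs0 : ∑' e, (q e : ℝ≥0∞) ^ 2 ≠ 0 := fun hs => h0 (by
    rw [ENNReal.tsum_eq_zero] at hs ⊢
    exact fun e => by simpa using hs e)
  have hC0 : (C.toNNReal : ℝ≥0∞) ≠ 0 := (ENNReal.ofReal_pos.2 hC).ne'
  -- With infinite total mass the right side is infinite, because its other two factors are nonzero.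
  by_cases ht' : ∑' e, (q e : ℝ≥0∞) = ⊤
  · rw [ht', ENNReal.mul_top]
    · exact le_top
    · refine mul_ne_zero hC0 ?_
      rw [Ne, ENNReal.rpow_eq_zero_iff_of_pos hexp]
      exact hs0
  obtain ⟨S, hS0, hS1, hS2⟩ := h v hv q hq ht' h0
  have hst : ∑' e, (q e : ℝ≥0∞) ^ 2 ≠ ⊤ :=
    ne_top_of_le_ne_top (ENNReal.pow_ne_top ht') (FPP.tsum_sq_le_sq_tsum q)
  simp only [FPP.geodesicProb_eq ht]
  rw [← FPP.lintegral_geodesicWeight G q 0 v]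
  refine (pow_le_pow_left' hS1 d).trans ?_
  rw [← ENNReal.ofReal_pow hS0]
  refine (ENNReal.ofReal_le_ofReal hS2).trans (le_of_eq ?_)
  rw [ENNReal.ofReal_mul (by positivity), ENNReal.ofReal_mul hC.le, ENNReal.ofReal_toReal ht',
    ENNReal.ofReal_pow (Real.sqrt_nonneg _)]
  congr 2
  · rw [Real.sqrt_eq_rpow, ← ENNReal.ofReal_rpow_of_nonneg ENNReal.toReal_nonneg (by norm_num),
      ENNReal.ofReal_toReal hst, ← ENNReal.rpow_natCast, ← ENNReal.rpow_mul]
    congr 1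
    rw [Nat.cast_sub (by omega)]
    push_cast
    ring
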